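/- **Theorem (Batch LTL Bound).** Let $d\ge 0$ and $n,T\ge 1$ be integers, let $\lambda>0$, let $\mathcal X\subseteq\mathbb R^d$ be contained in the Euclidean unit ball $\mathcal B_1$ centred at $0$, let $\mathcal Y\subseteq[0,1]$, $\mathcal Z=\mathcal X\times\mathcal Y$, and let $\ell(y,y')=(y-y')^2$ be the square loss. For $w\in\mathbb R^d$, a dataset $Z=((x_i,y_i))_{i=1}^n\in\mathcal Z^n$ and a probability measure $\mu$ on $\mathcal Z$ (a task) put $$\mathcal R_Z(w)=\frac1n\sum_{i=1}^n\ell(w^\top x_i,y_i),\qquad \mathcal R_\mu(w)=\mathbb E_{(x,y)\sim\mu}\,\ell(w^\top x,y).$$ For a positive semidefinite matrix $D\in\mathbb R^{d\times d}$ with Moore–Penrose pseudoinverse $D^\dagger$ let $A_D(Z)$ be the (unique) minimizer of $\mathcal R_Z(w)+w^\top D^\dagger w$ over $w\in\mathrm{Ran}(D)$, and let $\mathfrak D_\lambda=\{D\in\mathbb R^{d\times d}: D\succeq0,\ \mathrm{tr}(D)\le 1/\lambda\}$. Let $\rho$ (the environment) be a probability measure on the set of probability measures on $\mathcal Z$,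 and define the transfer risk $$\mathcal E(D)=\mathbb E_{\mu\sim\rho}\,\mathbb E_{Z\sim\mu^n}\,\mathcal R_\mu\big(A_D(Z)\big)$$ and the matrix $C_\rho=\mathbb E_{\mu\sim\rho}\mathbb E_{(x,y)\sim\mu}[xx^\top]$, whose operator norm (largest singular value) is written $\|C_\rho\|_\infty$. Let $D_*$ be a minimizer of $\mathcal E$ over $\mathfrak D_\lambda$. Let the tasks $\mu_1,\dots,\mu_T$ be sampled independently from $\rho$ and, for each $t$, let $Z_t$ be sampled from $\mu_t^n$, so that the pairs $(\mu_t,Z_t)$ are independent. Let $\hat D_T$ be a minimizer over $\mathfrak D_\lambda$ of the multitask empirical risk $$\hat{\mathcal E}_{\mathbf Z}(D)=\frac1T\sum_{t=1}^T\mathcal R_{Z_t}\big(A_D(Z_t)\big).$$ Then, for every $\delta\in(0,1]$, with probability at least $1-\delta$, $$\mathcal E(\hat D_T)-\mathcal E(D_*)\le\frac{4\sqrt{2\pi}\,\|C_\rho\|_\infty^{1/2}}{\sqrt n}\,\frac{1+\sqrt\lambda}{\lambda}+\frac{2\sqrt{2\pi}}{\lambda\sqrt T}+\sqrt{\frac{2\log(2/\delta)}{T}}.$$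 -/

import Mathlib

open MeasureTheory ProbabilityTheory
open scoped Matrix

namespace LTL

/-- `P` is a Moore–Penrose pseudoinverse of the real square matrix `A` (the four Penrose
conditions). -/
structure IsMoorePenrose {d : ℕ} (A P : Matrix (Fin d) (Fin d) ℝ) : Prop where
  mul_mul_self : A * P * A = A
  self_mul_mul : P * A * P = P
  isSymm_left : (A * P)ᵀ = A * P
  isSymm_right : (P * A)ᵀ = P * A

theorem IsMoorePenrose.unique {d : ℕ} {A P Q : Matrix (Fin d) (Fin d) ℝ}
    (hP : IsMoorePenrose A P) (hQ : IsMoorePenrose A Q) : P = Q := by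
  have h1 : A * P = A * Q := by
    have e : (A * P)ᵀ = A * P := hP.isSymm_left
    calc A * P = (A * Q * A) * P := by rw [hQ.mul_mul_self]
      _ = (A * Q)ᵀ * (A * P)ᵀ := by rw [hP.isSymm_left, hQ.isSymm_left]; simp only [mul_assoc]
      _ = ((A * P * A) * Q)ᵀ := by rw [← Matrix.transpose_mul]; simp only [mul_assoc]
      _ = A * Q := by rw [hP.mul_mul_self, hQ.isSymm_left]
  have h2 : P * A = Q * A := by
    calc P * A = P * (A * Q * A) := by rw [hQ.mul_mul_self]
      _ = (P * A)ᵀ * (Q * A)ᵀ := by rw [hP.isSymm_right, hQ.isSymm_right]; simp only [mul_assoc]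
      _ = (Q * (A * P * A))ᵀ := by rw [← Matrix.transpose_mul]; simp only [mul_assoc]
      _ = Q * A := by rw [hP.mul_mul_self, hQ.isSymm_right]
  calc P = P * A * P := hP.self_mul_mul.symm
    _ = Q * (A * P) := by rw [h2, mul_assoc]
    _ = Q := by rw [h1, ← mul_assoc, hQ.self_mul_mul]

theorem exists_isMoorePenrose {d : ℕ} {A : Matrix (Fin d) (Fin d) ℝ} (hA : A.IsHermitian) :
    ∃ P, IsMoorePenrose A P := by
  obtain ⟨U, e, hU, hAe⟩ : ∃ (U : Matrix (Fin d) (Fin d) ℝ) (e : Fin d → ℝ),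
      Uᵀ * U = 1 ∧ A = U * Matrix.diagonal e * Uᵀ := by
    refine ⟨hA.eigenvectorUnitary, hA.eigenvalues, ?_, ?_⟩
    · have := Unitary.coe_star_mul_self hA.eigenvectorUnitary
      simpa [Matrix.star_eq_conjTranspose] using this
    · have := hA.spectral_theorem
      rw [Unitary.conjStarAlgAut_apply] at this
      simpa [Matrix.star_eq_conjTranspose, Function.comp_def] using this
  have key : ∀ f g : Fin d → ℝ, (U * Matrix.diagonal f * Uᵀ) * (U * Matrix.diagonal g * Uᵀ)
      = U * Matrix.diagonal (fun i => f i * g i) * Uᵀ := by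
    intro f g
    calc _ = U * Matrix.diagonal f * (Uᵀ * U) * Matrix.diagonal g * Uᵀ := by
          simp only [mul_assoc]
      _ = _ := by rw [hU, mul_one, mul_assoc U, Matrix.diagonal_mul_diagonal]
  have symm : ∀ f : Fin d → ℝ, (U * Matrix.diagonal f * Uᵀ)ᵀ = U * Matrix.diagonal f * Uᵀ := by
    intro f
    simp [Matrix.transpose_mul, mul_assoc]
  refine ⟨U * Matrix.diagonal (fun i => (e i)⁻¹) * Uᵀ, ?_, ?_, ?_, ?_⟩ <;> subst hAe
  · rw [key, key]; congr 3; ext i; by_cases h : e i = 0 <;> simp [h]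
  · rw [key, key]; congr 3; ext i; by_cases h : e i = 0 <;> simp [h]
  · rw [key, symm]
  · rw [key, symm]

/-- The Moore–Penrose pseudoinverse `D†` (it exists for symmetric `D` by
`exists_isMoorePenrose` and is unique by `IsMoorePenrose.unique`). -/
noncomputable def pinv {d : ℕ} (A : Matrix (Fin d) (Fin d) ℝ) : Matrix (Fin d) (Fin d) ℝ :=
  Classical.epsilon (IsMoorePenrose A)

theorem isMoorePenrose_pinv {d : ℕ} {A : Matrix (Fin d) (Fin d) ℝ} (hA : A.IsHermitian) :
    IsMoorePenrose A (pinv A) :=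
  Classical.epsilon_spec (exists_isMoorePenrose hA)

/-- The space `𝒵 = 𝒳 × 𝒴` of labelled points, for an input set `𝒳 ⊆ ℝᵈ` (with its Euclidean
norm) and an output set `𝒴 ⊆ ℝ`. -/
abbrev Point {d : ℕ} (𝒳 : Set (EuclideanSpace ℝ (Fin d))) (𝒴 : Set ℝ) : Type := ↥𝒳 × ↥𝒴

/-- The square loss. -/
def sqLoss (y y' : ℝ) : ℝ := (y - y') ^ 2

section

variable {d : ℕ} {𝒳 : Set (EuclideanSpace ℝ (Fin d))} {𝒴 : Set ℝ}

/-- The loss `ℓ(⟨w, x⟩, y)` at `z = (x, y)` of the linear predictor `x ↦ wᵀ x`. -/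
def pointLoss (w : Fin d → ℝ) (z : Point 𝒳 𝒴) : ℝ :=
  sqLoss (w ⬝ᵥ WithLp.ofLp (z.1 : EuclideanSpace ℝ (Fin d))) (z.2 : ℝ)

/-- The empirical risk `ℛ_Z(w)` of the linear predictor `w` on the dataset `Z`. -/
noncomputable def empRisk {n : ℕ} (Z : Fin n → Point 𝒳 𝒴) (w : Fin d → ℝ) : ℝ :=
  (1 / (n : ℝ)) * ∑ i, pointLoss w (Z i)

/-- The expected risk `ℛ_μ(w)` of the linear predictor `w` on the task `μ`. -/
noncomputable def risk (μ : ProbabilityMeasure (Point 𝒳 𝒴)) (w : Fin d → ℝ) : ℝ :=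
  ∫ z, pointLoss w z ∂(μ : Measure (Point 𝒳 𝒴))

/-- The regularized objective `ℛ_Z(w) + wᵀ D† w`. -/
noncomputable def ridgeObjective {n : ℕ} (D : Matrix (Fin d) (Fin d) ℝ)
    (Z : Fin n → Point 𝒳 𝒴) (w : Fin d → ℝ) : ℝ :=
  empRisk Z w + w ⬝ᵥ (pinv D *ᵥ w)

/-- `w` minimizes `ℛ_Z(w) + wᵀ D† w` over `w ∈ Ran(D)`. -/
def IsRidgeSolution {n : ℕ} (D : Matrix (Fin d) (Fin d) ℝ)
    (Z : Fin n → Point 𝒳 𝒴) (w : Fin d → ℝ) : Prop :=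
  w ∈ LinearMap.range D.mulVecLin ∧
    ∀ w' ∈ LinearMap.range D.mulVecLin, ridgeObjective D Z w ≤ ridgeObjective D Z w'

/-- The learning algorithm `A_D(Z) = argmin_{w ∈ Ran(D)} ℛ_Z(w) + wᵀ D† w`
(for positive semidefinite `D` the minimizer exists and is unique, see
`existsUnique_isRidgeSolution`). -/
noncomputable def ridge {n : ℕ} (D : Matrix (Fin d) (Fin d) ℝ)
    (Z : Fin n → Point 𝒳 𝒴) : Fin d → ℝ :=
  Classical.epsilon (IsRidgeSolution D Z)

theorem existsUnique_isRidgeSolution {n : ℕ} (hn : 0 < n) {D : Matrix (Fin d) (Fin d) ℝ}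
    (hD : D.PosSemidef) (Z : Fin n → Point 𝒳 𝒴) : ∃! w, IsRidgeSolution D Z w := by
  have hn' : (n : ℝ) ≠ 0 := by positivity
  have hn0 : (0 : ℝ) < n := by positivity
  have hsymm : Dᵀ = D := by simpa [Matrix.IsHermitian] using hD.isHermitian
  have hb : ∀ u v : Fin d → ℝ, (D *ᵥ u) ⬝ᵥ v = u ⬝ᵥ (D *ᵥ v) := by
    intro u v
    rw [Matrix.dotProduct_mulVec, ← Matrix.mulVec_transpose, hsymm]
  have hpen : ∀ v : Fin d → ℝ, (D *ᵥ v) ⬝ᵥ (pinv D *ᵥ (D *ᵥ v)) = v ⬝ᵥ (D *ᵥ v) := by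
    intro v
    rw [hb, Matrix.mulVec_mulVec, Matrix.mulVec_mulVec,
      (isMoorePenrose_pinv hD.isHermitian).mul_mul_self]
  let X : Matrix (Fin n) (Fin d) ℝ := Matrix.of fun i => WithLp.ofLp (Z i).1.1
  let y : Fin n → ℝ := fun i => (Z i).2.1
  have hM : (X * D * Xᵀ + (n : ℝ) • (1 : Matrix (Fin n) (Fin n) ℝ)).PosDef := by
    refine Matrix.PosDef.posSemidef_add ?_ (Matrix.PosDef.one.smul hn0)
    simpa using hD.mul_mul_conjTranspose_same X
  obtain ⟨a, ha⟩ : ∃ a, (X * D * Xᵀ + (n : ℝ) • (1 : Matrix (Fin n) (Fin n) ℝ)) *ᵥ a = y := by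
    refine ⟨(X * D * Xᵀ + (n : ℝ) • (1 : Matrix (Fin n) (Fin n) ℝ))⁻¹ *ᵥ y, ?_⟩
    rw [Matrix.mulVec_mulVec, Matrix.mul_nonsing_inv _ ((Matrix.isUnit_iff_isUnit_det _).1
      hM.isUnit), Matrix.one_mulVec]
  let u : Fin d → ℝ := Xᵀ *ᵥ a
  have hr : ∀ i, X i ⬝ᵥ (D *ᵥ u) - y i = -(n : ℝ) * a i := by
    intro i
    have := congrFun ha i
    rw [Matrix.add_mulVec, Matrix.smul_mulVec, Matrix.one_mulVec, ← Matrix.mulVec_mulVec,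
      ← Matrix.mulVec_mulVec] at this
    simp only [Pi.add_apply, Pi.smul_apply, smul_eq_mul] at this
    have h2 : (X *ᵥ (D *ᵥ u)) i = X i ⬝ᵥ (D *ᵥ u) := rfl
    rw [← h2, ← this]
    ring
  have hcross : ∀ v : Fin d → ℝ, ∑ i, a i * (X i ⬝ᵥ (D *ᵥ v)) = u ⬝ᵥ (D *ᵥ v) := by
    intro v
    change a ⬝ᵥ (X *ᵥ (D *ᵥ v)) = _
    rw [Matrix.dotProduct_mulVec, ← Matrix.mulVec_transpose]
  have hexp : ∀ v : Fin d → ℝ, ridgeObjective D Z (D *ᵥ (u + v)) = ridgeObjective D Z (D *ᵥ u)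
      + (1 / (n : ℝ)) * ∑ i, (X i ⬝ᵥ (D *ᵥ v)) ^ 2 + v ⬝ᵥ (D *ᵥ v) := by
    intro v
    have hemp : ∀ w, empRisk Z w = (1 / (n : ℝ)) * ∑ i, (X i ⬝ᵥ w - y i) ^ 2 := by
      intro w
      unfold empRisk pointLoss sqLoss
      congr 1
      refine Finset.sum_congr rfl fun i _ => ?_
      rw [dotProduct_comm]; rfl
    have hvu : v ⬝ᵥ (D *ᵥ u) = u ⬝ᵥ (D *ᵥ v) := by rw [← hb, dotProduct_comm]
    have hsum : ∑ i, (X i ⬝ᵥ (D *ᵥ u + D *ᵥ v) - y i) ^ 2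
        = ∑ i, (X i ⬝ᵥ (D *ᵥ u) - y i) ^ 2 - 2 * (n : ℝ) * (u ⬝ᵥ (D *ᵥ v))
          + ∑ i, (X i ⬝ᵥ (D *ᵥ v)) ^ 2 := by
      rw [← hcross, Finset.mul_sum, ← Finset.sum_sub_distrib, ← Finset.sum_add_distrib]
      refine Finset.sum_congr rfl fun i _ => ?_
      rw [dotProduct_add]
      linear_combination (2 * (X i ⬝ᵥ (D *ᵥ v))) * hr i
    simp only [ridgeObjective]
    rw [hpen, hpen, hemp, hemp, Matrix.mulVec_add, hsum]
    simp only [add_dotProduct, dotProduct_add, hvu]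
    field_simp
    ring
  have hnn : ∀ v : Fin d → ℝ, 0 ≤ v ⬝ᵥ (D *ᵥ v) := by
    intro v
    simpa using hD.dotProduct_mulVec_nonneg v
  refine ⟨D *ᵥ u, ⟨⟨u, rfl⟩, ?_⟩, ?_⟩
  · rintro _ ⟨v, rfl⟩
    have h := hexp (v - u)
    rw [add_sub_cancel] at h
    have h3 : 0 ≤ (1 / (n : ℝ)) * ∑ i, (X i ⬝ᵥ (D *ᵥ (v - u))) ^ 2 := by positivity
    have h4 := hnn (v - u)
    rw [Matrix.mulVecLin_apply]
    linarith
  · rintro _ ⟨⟨v, rfl⟩, hmin⟩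
    have hle := hmin (D *ᵥ u) ⟨u, rfl⟩
    have h := hexp (v - u)
    rw [add_sub_cancel] at h
    have h3 : 0 ≤ (1 / (n : ℝ)) * ∑ i, (X i ⬝ᵥ (D *ᵥ (v - u))) ^ 2 := by positivity
    have h4 := hnn (v - u)
    rw [Matrix.mulVecLin_apply] at hle ⊢
    have h5 : (v - u) ⬝ᵥ (D *ᵥ (v - u)) = 0 := by linarith
    have h6 : D *ᵥ (v - u) = 0 := by
      refine (hD.dotProduct_mulVec_zero_iff _).1 ?_
      simpa using h5
    rwa [Matrix.mulVec_sub, sub_eq_zero] at h6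

/-- The Markov kernel `μ ↦ μⁿ`, the law of a dataset of `n` independent points of the task `μ`. -/
noncomputable def datasetKernel (𝒳 : Set (EuclideanSpace ℝ (Fin d))) (𝒴 : Set ℝ) (n : ℕ) :
    Kernel (ProbabilityMeasure (Point 𝒳 𝒴)) (Fin n → Point 𝒳 𝒴) where
  toFun μ := Measure.pi fun _ : Fin n => (μ : Measure (Point 𝒳 𝒴))
  measurable' := by
    refine Measurable.measure_of_isPiSystem_of_isProbabilityMeasure generateFrom_pi.symm
      isPiSystem_pi ?_
    rintro _ ⟨s, hs, rfl⟩
    simp_rw [Measure.pi_pi]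
    refine Finset.measurable_fun_prod _ fun i _ => ?_
    have hsi : MeasurableSet (s i) := hs i (Set.mem_univ i)
    exact (Measure.measurable_coe hsi).comp measurable_subtype_coe

instance (𝒳 : Set (EuclideanSpace ℝ (Fin d))) (𝒴 : Set ℝ) (n : ℕ) :
    IsMarkovKernel (datasetKernel 𝒳 𝒴 n) :=
  ⟨fun μ => inferInstanceAs
    (IsProbabilityMeasure (Measure.pi fun _ : Fin n => (μ : Measure (Point 𝒳 𝒴))))⟩

/-- The transfer risk `ℰ(D) = 𝔼_{μ ∼ ρ} 𝔼_{Z ∼ μⁿ} ℛ_μ(A_D(Z))`. -/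
noncomputable def transferRisk (ρ : Measure (ProbabilityMeasure (Point 𝒳 𝒴))) (n : ℕ)
    (D : Matrix (Fin d) (Fin d) ℝ) : ℝ :=
  ∫ μ, ∫ Z, risk μ (ridge D Z) ∂(datasetKernel 𝒳 𝒴 n μ) ∂ρ

/-- The multitask empirical risk `(1/T) ∑ₜ ℛ_{Zₜ}(A_D(Zₜ))`. -/
noncomputable def multitaskEmpRisk {n T : ℕ} (Z : Fin T → Fin n → Point 𝒳 𝒴)
    (D : Matrix (Fin d) (Fin d) ℝ) : ℝ :=
  (1 / (T : ℝ)) * ∑ t, empRisk (Z t) (ridge D (Z t))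

/-- The matrix `C_ρ = 𝔼_{μ ∼ ρ} 𝔼_{(x, y) ∼ μ} [x xᵀ]`. -/
noncomputable def covMatrix (ρ : Measure (ProbabilityMeasure (Point 𝒳 𝒴))) :
    Matrix (Fin d) (Fin d) ℝ :=
  Matrix.of fun i j => ∫ μ, ∫ z, z.1.1 i * z.1.1 j ∂(μ : Measure (Point 𝒳 𝒴)) ∂ρ

end

/-- The set `𝔇_λ` of positive semidefinite `d × d` matrices with trace at most `1 / λ`. -/
def reprSet (d : ℕ) (lam : ℝ) : Set (Matrix (Fin d) (Fin d) ℝ) :=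
  {D | D.PosSemidef ∧ D.trace ≤ 1 / lam}

/-- The spectral norm (largest singular value) of a real square matrix. -/
noncomputable def opNorm {d : ℕ} (A : Matrix (Fin d) (Fin d) ℝ) : ℝ :=
  ‖Matrix.toEuclideanCLM (n := Fin d) (𝕜 := ℝ) A‖

end LTL

/-! Write `f_D(Z)` for the training error of ridge regression with matrix `D` on the dataset `Z`,
and `F(D)` for its mean under `datasetLaw ρ n`, the law of the dataset of a random task. The excess
`ℰ(D̂) - ℰ(D⋆)` splits into two gaps `ℰ - F`, at `D̂` and at `D⋆`, and the difference `F(D̂) -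
F(D⋆)`.

Each gap is a generalization error for fixed `D`, averaged over tasks (`abs_transferRisk_sub_le`).
Factor `D = BᵀB`. The ridge solution is `Bᵀv` with `‖v‖ ≤ 1` (`exists_ridge_eq`), so risk minus
training error is a quadratic polynomial in `v` whose coefficients are centred empirical means of
products of the features `Bx` and the label. Bounding it over the whole unit ball takes only
Cauchy–Schwarz and variances (`abs_empRisk_sub_risk_le`), and gives a multiple of `√(𝔼‖Bx‖² / n)`.
Averaged over tasks, `𝔼‖Bx‖² = tr(D C_ρ) ≤ ‖C_ρ‖ / λ`.

For the difference, optimality of `D̂` on the sample reduces it to the uniform deviation of the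
centred sums of `f_D - f_{D⋆}` over the `T` independent datasets. The key fact is that `f_D(Z)` is
2-Lipschitz in the normalized kernel matrix `X D Xᵀ / n` for the Frobenius norm
(`abs_empRisk_ridge_sub_le`), and that matrix is linear in `D`. Symmetrization and comparison with a
Gaussian process (`integral_iSup_sub_le`, tensorized by `integral_iSup_sum_le`) bound the expected
supremum by that of a linear function of `D`. Since `‖D‖_F ≤ tr D ≤ 1/λ`, Cauchy–Schwarz and a
second moment finish this part (`integral_iSup_sum_empRisk_le`). McDiarmid's inequality turns the
expectation into a high-probability bound.

Suprema are taken over finite families, which settles measurability and attainment; a dense sequence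
in `𝔇_λ` and continuity in `D` then give the whole class (`exists_measurableSet_excess_le`). -/

namespace LTL

/-! ### Finite suprema of random variables. -/

section Supremum

variable {ι : Type*} [Finite ι] {Ω : Type*} [MeasurableSpace Ω]

theorem le_iSup_of_finite (F : ι → ℝ) (i : ι) : F i ≤ ⨆ i, F i :=
  le_ciSup (Set.finite_range F).bddAbove i

theorem integrable_iSup_of_finite {m : Measure Ω} {F : ι → Ω → ℝ}
    (hm : ∀ i, Measurable (F i)) (hF : ∀ i, Integrable (F i) m) :
    Integrable (fun x => ⨆ i, F i x) m := by
  have := Fintype.ofFinite ι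
  refine Integrable.mono' (integrable_finsetSum Finset.univ fun i _ => (hF i).abs)
    (Measurable.iSup hm).aestronglyMeasurable (Filter.Eventually.of_forall fun x => ?_)
  rcases isEmpty_or_nonempty ι with h | h
  · simp
  · obtain ⟨i, hi⟩ := exists_eq_ciSup_of_finite (f := fun i => F i x)
    rw [← hi, Real.norm_eq_abs]
    exact Finset.single_le_sum (f := fun i => |F i x|) (fun i _ => abs_nonneg _)
      (Finset.mem_univ i)

end Supremum

/-! ### Independent copies: peeling off a coordinate, second moments of sums, Jensen for the square
root. -/

section Product

variable {Ω : Type*} [MeasurableSpace Ω] (m : Measure Ω) [IsProbabilityMeasure m]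

theorem measurePreserving_cons (k : ℕ) :
    MeasurePreserving (fun p : Ω × (Fin k → Ω) => (Fin.cons p.1 p.2 : Fin (k + 1) → Ω))
      (m.prod (Measure.pi fun _ : Fin k => m)) (Measure.pi fun _ : Fin (k + 1) => m) := by
  have := (measurePreserving_piFinSuccAbove (fun _ : Fin (k + 1) => m) 0).symm
  have e : (fun p : Ω × (Fin k → Ω) => (Fin.cons p.1 p.2 : Fin (k + 1) → Ω))
      = (MeasurableEquiv.piFinSuccAbove (fun _ : Fin (k + 1) => Ω) 0).symm := by
    funext p
    exact (Fin.insertNth_zero' p.1 p.2).symm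
  rw [e]
  exact this

theorem integral_pi_cons {k : ℕ} (F : (Fin (k + 1) → Ω) → ℝ) :
    ∫ x, F x ∂(Measure.pi fun _ : Fin (k + 1) => m)
      = ∫ p, F (Fin.cons p.1 p.2) ∂(m.prod (Measure.pi fun _ : Fin k => m)) := by
  rw [← ((measurePreserving_piFinSuccAbove (fun _ : Fin (k + 1) => m) 0).symm).integral_comp' F]
  refine integral_congr_ae (Filter.Eventually.of_forall fun p => ?_)
  exact congrArg F (Fin.insertNth_zero' p.1 p.2)

theorem integrable_eval {T : ℕ} {h : Ω → ℝ} (hh : Integrable h m) (t : Fin T) :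
    Integrable (fun x => h (x t)) (Measure.pi fun _ : Fin T => m) :=
  integrable_comp_eval (μ := fun _ : Fin T => m) hh

theorem integral_eval {T : ℕ} {h : Ω → ℝ} (hh : Integrable h m) (t : Fin T) :
    ∫ x, h (x t) ∂(Measure.pi fun _ : Fin T => m) = ∫ x, h x ∂m :=
  integral_comp_eval (μ := fun _ : Fin T => m) hh.aestronglyMeasurable

/-- The second moment of a centred sum of independent copies. -/
theorem integral_sq_sum_sub_le {T : ℕ} {h : Ω → ℝ} (hh : MemLp h 2 m) :
    ∫ x, (∑ t, (h (x t) - ∫ y, h y ∂m)) ^ 2 ∂(Measure.pi fun _ : Fin T => m)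
      ≤ T * ∫ y, h y ^ 2 ∂m := by
  have hi : Integrable h m := hh.integrable (by norm_num)
  have h1 := variance_sum_pi (μ := fun _ : Fin T => m) (X := fun _ => h) (fun _ => hh)
  have hmem : MemLp (∑ t, fun x : Fin T → Ω => h (x t)) 2 (Measure.pi fun _ : Fin T => m) :=
    memLp_finsetSum' _ fun t _ => hh.comp_measurePreserving (measurePreserving_eval _ t)
  rw [variance_eq_integral hmem.aemeasurable] at h1
  have h2 : ∫ x, (∑ t, fun x : Fin T → Ω => h (x t)) x ∂(Measure.pi fun _ : Fin T => m)
      = ∑ _t : Fin T, ∫ y, h y ∂m := by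
    simp_rw [Finset.sum_apply]
    rw [integral_finsetSum _ fun t _ => integrable_eval m hi t]
    exact Finset.sum_congr rfl fun t _ => integral_eval m hi t
  rw [h2] at h1
  simp only [Finset.sum_apply, ← Finset.sum_sub_distrib] at h1
  rw [h1, Finset.sum_const, Finset.card_univ, Fintype.card_fin, nsmul_eq_mul]
  gcongr
  have := variance_le_expectation_sq (μ := m) (X := h) hh.aestronglyMeasurable
  simpa using this

theorem integrable_sq_sum_sub {T : ℕ} {h : Ω → ℝ} (hh : MemLp h 2 m) (c : ℝ) :
    Integrable (fun x => (∑ t, (h (x t) - c)) ^ 2) (Measure.pi fun _ : Fin T => m) := by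
  refine MemLp.integrable_sq (memLp_finsetSum _ fun t _ => ?_)
  exact (hh.sub (memLp_const c)).comp_measurePreserving
    (measurePreserving_eval (fun _ : Fin T => m) t)

/-- Jensen's inequality for the square root. -/
theorem integral_le_sqrt_integral {F G : Ω → ℝ} (hF : AEStronglyMeasurable F m)
    (hG : Integrable G m) (hFG : ∀ x, F x ^ 2 ≤ G x) :
    Integrable F m ∧ ∫ x, F x ∂m ≤ √(∫ x, G x ∂m) := by
  have hsq : Integrable (fun x => F x ^ 2) m :=
    hG.mono' (hF.pow 2) (Filter.Eventually.of_forall fun x => by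
      rw [Real.norm_eq_abs, abs_of_nonneg (sq_nonneg _)]; exact hFG x)
  have hmem : MemLp F 2 m := (memLp_two_iff_integrable_sq hF).2 hsq
  have hi : Integrable F m := hmem.integrable (by norm_num)
  refine ⟨hi, Real.le_sqrt_of_sq_le ?_⟩
  have hv := variance_nonneg F m
  rw [variance_eq_sub hmem] at hv
  have : ∫ x, F x ^ 2 ∂m ≤ ∫ x, G x ∂m := integral_mono hsq hG hFG
  simp only [Pi.pow_apply] at hv
  linarith

end Product

/-! ### Passing from one summand to sums of independent copies. -/

section Tensorization

variable {ι : Type*} [Finite ι] {Ω₁ Ω₂ : Type*} [MeasurableSpace Ω₁] [MeasurableSpace Ω₂]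

/-- A comparison of expected suprema that holds for one summand, whatever the offset, holds for
sums of independent copies. -/
theorem integral_iSup_sum_le (m₁ : Measure Ω₁) (m₂ : Measure Ω₂) [IsProbabilityMeasure m₁]
    [IsProbabilityMeasure m₂] {h : ι → Ω₁ → ℝ} {q : ι → Ω₂ → ℝ}
    (hhm : ∀ i, Measurable (h i)) (hh : ∀ i, Integrable (h i) m₁)
    (hqm : ∀ i, Measurable (q i)) (hq : ∀ i, Integrable (q i) m₂)
    (hstep : ∀ A : ι → ℝ, ∫ x, ⨆ i, (A i + h i x) ∂m₁ ≤ ∫ y, ⨆ i, (A i + q i y) ∂m₂)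
    (T : ℕ) (A : ι → ℝ) :
    ∫ x, ⨆ i, (A i + ∑ t, h i (x t)) ∂(Measure.pi fun _ : Fin T => m₁)
      ≤ ∫ y, ⨆ i, (A i + ∑ t, q i (y t)) ∂(Measure.pi fun _ : Fin T => m₂) := by
  induction T generalizing A with
  | zero => simp
  | succ k ih =>
    rw [integral_pi_cons, integral_pi_cons]
    simp only [Fin.sum_univ_succ, Fin.cons_zero, Fin.cons_succ]
    have e1 : Integrable (fun p : Ω₁ × (Fin k → Ω₁) => ⨆ i, (A i + (h i p.1 + ∑ t, h i (p.2 t))))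
        (m₁.prod (Measure.pi fun _ => m₁)) := by
      refine integrable_iSup_of_finite (fun i => by fun_prop) fun i => ?_
      refine (integrable_const _).add (((hh i).comp_fst _).add ?_)
      exact Integrable.comp_snd (f := fun x : Fin k → Ω₁ => ∑ t, h i (x t))
        (integrable_finsetSum _ fun t _ => integrable_eval m₁ (hh i) t) _
    have e2 : Integrable (fun p : Ω₂ × (Fin k → Ω₁) => ⨆ i, (A i + (q i p.1 + ∑ t, h i (p.2 t))))
        (m₂.prod (Measure.pi fun _ => m₁)) := by
      refine integrable_iSup_of_finite (fun i => by fun_prop) fun i => ?_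
      refine (integrable_const _).add (((hq i).comp_fst _).add ?_)
      exact Integrable.comp_snd (f := fun x : Fin k → Ω₁ => ∑ t, h i (x t))
        (integrable_finsetSum _ fun t _ => integrable_eval m₁ (hh i) t) _
    have e3 : Integrable (fun p : Ω₂ × (Fin k → Ω₂) => ⨆ i, (A i + (q i p.1 + ∑ t, q i (p.2 t))))
        (m₂.prod (Measure.pi fun _ => m₂)) := by
      refine integrable_iSup_of_finite (fun i => by fun_prop) fun i => ?_
      refine (integrable_const _).add (((hq i).comp_fst _).add ?_)
      exact Integrable.comp_snd (f := fun x : Fin k → Ω₂ => ∑ t, q i (x t))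
        (integrable_finsetSum _ fun t _ => integrable_eval m₂ (hq i) t) _
    -- Conditionally on the last `k` coordinates their sum is a deterministic offset, so `hstep`
    -- exchanges the first summand. After swapping the order of integration, the exchanged summand
    -- is an offset in turn and the induction hypothesis treats the rest.
    calc _ = ∫ x, ∫ x₀, ⨆ i, (A i + (h i x₀ + ∑ t, h i (x t))) ∂m₁
            ∂(Measure.pi fun _ : Fin k => m₁) := integral_prod_symm _ e1
      _ ≤ ∫ x, ∫ y₀, ⨆ i, (A i + (q i y₀ + ∑ t, h i (x t))) ∂m₂
            ∂(Measure.pi fun _ : Fin k => m₁) := by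
          refine integral_mono e1.integral_prod_right e2.integral_prod_right fun x => ?_
          have := hstep fun i => A i + ∑ t, h i (x t)
          simpa only [add_assoc, add_comm (Finset.sum _ _)] using this
      _ = ∫ y₀, ∫ x, ⨆ i, (A i + (q i y₀ + ∑ t, h i (x t))) ∂(Measure.pi fun _ : Fin k => m₁)
            ∂m₂ := by rw [← integral_prod_symm _ e2, integral_prod _ e2]
      _ ≤ ∫ y₀, ∫ y, ⨆ i, (A i + (q i y₀ + ∑ t, q i (y t))) ∂(Measure.pi fun _ : Fin k => m₂)
            ∂m₂ := by
          refine integral_mono e2.integral_prod_left e3.integral_prod_left fun y₀ => ?_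
          have := ih fun i => A i + q i y₀
          simpa only [add_assoc] using this
      _ = _ := (integral_prod _ e3).symm

end Tensorization

/-! ### Standard Gaussian vectors and the comparison with a Gaussian process. -/

section Gaussian

theorem integral_abs_gaussianReal_one : ∫ x, |x| ∂(gaussianReal 0 1) = √(2 / Real.pi) := by
  rw [integral_gaussianReal_eq_integral_smul one_ne_zero]
  have h1 : ∀ x : ℝ, gaussianPDFReal 0 1 x • |x|
      = (fun y => (√(2 * Real.pi))⁻¹ * (y ^ (1 : ℝ) * Real.exp (-(1 / 2) * y ^ (2 : ℝ)))) |x| := by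
    intro x
    simp only [gaussianPDFReal, smul_eq_mul, Real.rpow_one, Real.rpow_two, sq_abs]
    simp only [NNReal.coe_one, mul_one, sub_zero]
    rw [show -x ^ 2 / 2 = -(1 / 2) * x ^ 2 by ring]
    ring
  simp_rw [h1]
  rw [integral_comp_abs (f := fun y => (√(2 * Real.pi))⁻¹ *
    (y ^ (1 : ℝ) * Real.exp (-(1 / 2) * y ^ (2 : ℝ)))), integral_const_mul,
    integral_rpow_mul_exp_neg_mul_rpow (by norm_num) (by norm_num) (by norm_num)]
  norm_num [Real.rpow_neg_one]
  have hp := Real.pi_pos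
  have h2 : √2 * √2 = 2 := Real.mul_self_sqrt (by norm_num)
  field_simp
  linarith

variable {E : Type*} [NormedAddCommGroup E] [InnerProductSpace ℝ E] [FiniteDimensional ℝ E]
  [MeasurableSpace E] [BorelSpace E]

theorem map_inner_stdGaussian (v : E) :
    (stdGaussian E).map (fun g => inner ℝ v g)
      = (gaussianReal 0 1).map fun x => ‖v‖ * x := by
  have h := IsGaussian.map_eq_gaussianReal (μ := stdGaussian E) (innerSL ℝ v)
  rw [integral_strongDual_stdGaussian, variance_dual_stdGaussian, innerSL_apply_norm] at h
  rw [gaussianReal_map_const_mul]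
  have e : (‖v‖ ^ 2).toNNReal = NNReal.mk (‖v‖ ^ 2) (sq_nonneg _) * 1 := by
    ext; simp
  rw [mul_zero, ← e, ← h]
  rfl

theorem integrable_inner_stdGaussian (v : E) :
    Integrable (fun g => inner ℝ v g) (stdGaussian E) := by
  have := (innerSL ℝ v).integrable_comp (IsGaussian.integrable_id (μ := stdGaussian E))
  simpa using this

/-- Expresses a norm as the mean absolute value of a Gaussian linear form. Its inverse constant
`√(π/2)` is the price of the Gaussian comparison. -/
theorem integral_abs_inner_stdGaussian (v : E) :
    ∫ g, |inner ℝ v g| ∂(stdGaussian E) = √(2 / Real.pi) * ‖v‖ := by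
  have h1 : ∫ g, |inner ℝ v g| ∂(stdGaussian E)
      = ∫ x, |x| ∂((stdGaussian E).map fun g => inner ℝ v g) := by
    rw [integral_map (by fun_prop) (by fun_prop)]
  rw [h1, map_inner_stdGaussian, integral_map (by fun_prop) (by fun_prop)]
  simp_rw [abs_mul, abs_norm]
  rw [integral_const_mul, integral_abs_gaussianReal_one, mul_comm]

theorem integral_inner_stdGaussian (v : E) : ∫ g, inner ℝ v g ∂(stdGaussian E) = 0 := by
  simpa using integral_strongDual_stdGaussian (innerSL ℝ v)

theorem memLp_inner_stdGaussian (v : E) : MemLp (fun g => inner ℝ v g) 2 (stdGaussian E) := by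
  simpa using IsGaussian.memLp_dual (stdGaussian E) (innerSL ℝ v) 2 (by norm_num)

theorem integral_sq_inner_stdGaussian (v : E) :
    ∫ g, inner ℝ v g ^ 2 ∂(stdGaussian E) = ‖v‖ ^ 2 := by
  have h := variance_dual_stdGaussian (innerSL ℝ v)
  rw [innerSL_apply_norm, variance_eq_sub (by simpa using memLp_inner_stdGaussian v)] at h
  simpa [integral_inner_stdGaussian] using h

theorem integral_comp_neg_stdGaussian (F : E → ℝ) :
    ∫ g, F (-g) ∂(stdGaussian E) = ∫ g, F g ∂(stdGaussian E) := by
  have h := stdGaussian_map (LinearIsometryEquiv.neg ℝ (E := E))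
  have : MeasurePreserving (MeasurableEquiv.neg E) (stdGaussian E) (stdGaussian E) :=
    ⟨(MeasurableEquiv.neg E).measurable, h⟩
  exact this.integral_comp' F

variable {ι : Type*} [Finite ι]

theorem integrable_iSup_inner_stdGaussian (a : ι → ℝ) (v : ι → E) (c : ℝ) :
    Integrable (fun g => ⨆ i, (a i + c * inner ℝ (v i) g)) (stdGaussian E) :=
  integrable_iSup_of_finite (fun i => by fun_prop) fun i =>
    (integrable_const _).add ((integrable_inner_stdGaussian _).const_mul _)

/-- The contraction principle that compares a Rademacher sum with a Gaussian process, for one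
summand. -/
theorem iSup_add_iSup_sub_le [Nonempty ι] {a h : ι → ℝ} {v : ι → E} {L : ℝ}
    (hL : ∀ i j, |h i - h j| ≤ L * ‖v i - v j‖) :
    (⨆ i, (a i + h i)) + (⨆ i, (a i - h i))
      ≤ 2 * ∫ g, ⨆ i, (a i + √(Real.pi / 2) * L * inner ℝ (v i) g) ∂(stdGaussian E) := by
  -- Both suprema are attained, at `i` and `j`; only the pair `h i - h j` matters, and the Lipschitz
  -- bound replaces it by `L * ‖v i - v j‖`.
  obtain ⟨i, hi⟩ := exists_eq_ciSup_of_finite (f := fun i => a i + h i)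
  obtain ⟨j, hj⟩ := exists_eq_ciSup_of_finite (f := fun i => a i - h i)
  rw [← hi, ← hj]
  set c := √(Real.pi / 2) * L with hc
  have hint := integrable_iSup_inner_stdGaussian a v c
  have hint' : Integrable (fun g => ⨆ i, (a i + c * inner ℝ (v i) (-g))) (stdGaussian E) := by
    simpa [inner_neg_right] using integrable_iSup_inner_stdGaussian a v (-c)
  have hroot : √(Real.pi / 2) * √(2 / Real.pi) = 1 := by
    rw [← Real.sqrt_mul (by positivity)]
    have := Real.pi_pos
    rw [show Real.pi / 2 * (2 / Real.pi) = 1 by field_simp, Real.sqrt_one]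
  have habs := (integrable_inner_stdGaussian (v i - v j)).abs
  calc a i + h i + (a j - h j) ≤ a i + a j + L * ‖v i - v j‖ := by
        have := (le_abs_self _).trans (hL i j); linarith
    _ = ∫ g, (a i + a j + c * |inner ℝ (v i - v j) g|) ∂(stdGaussian E) := by
        rw [integral_add (integrable_const _) (habs.const_mul _), integral_const_mul,
          integral_abs_inner_stdGaussian]
        simp only [integral_const, probReal_univ, smul_eq_mul, one_mul]
        linear_combination (- L * ‖v i - v j‖) * hroot
    -- According to the sign of `⟨v i - v j, g⟩`, use `i` in the supremum at `g` and `j` in the one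
    -- at `-g`, or the reverse. The two suprema have equal means because `g` and `-g` have the same
    -- law.
    _ ≤ ∫ g, ((⨆ i, (a i + c * inner ℝ (v i) g)) + ⨆ i, (a i + c * inner ℝ (v i) (-g)))
          ∂(stdGaussian E) := by
        refine integral_mono ((integrable_const _).add (habs.const_mul _)) (hint.add hint')
          fun g => ?_
        have p1 := le_iSup_of_finite (fun i => a i + c * inner ℝ (v i) g) i
        have p2 := le_iSup_of_finite (fun i => a i + c * inner ℝ (v i) g) j
        have p3 := le_iSup_of_finite (fun i => a i + c * inner ℝ (v i) (-g)) i
        have p4 := le_iSup_of_finite (fun i => a i + c * inner ℝ (v i) (-g)) j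
        simp only [inner_neg_right] at p1 p2 p3 p4 ⊢
        rw [inner_sub_left]
        rcases abs_cases (inner ℝ (v i) g - inner ℝ (v j) g) with ⟨e, -⟩ | ⟨e, -⟩ <;> rw [e] <;>
          linarith
    _ = _ := by
        rw [integral_add hint hint',
          integral_comp_neg_stdGaussian fun g => ⨆ i, (a i + c * inner ℝ (v i) g), two_mul]

/-- Symmetrization and Gaussian contraction for one summand. -/
theorem integral_iSup_sub_le [Nonempty ι] {Ω : Type*} [MeasurableSpace Ω] (ν : Measure Ω)
    [IsProbabilityMeasure ν] {f : ι → Ω → ℝ} {φ : ι → Ω → E} {L : ℝ} {M : ι → ℝ}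
    (hfm : ∀ i, Measurable (f i)) (hf : ∀ i, Integrable (f i) ν) (hφ : ∀ i, Measurable (φ i))
    (hM : ∀ i z, ‖φ i z‖ ≤ M i)
    (hL : ∀ i j z, |f i z - f j z| ≤ L * ‖φ i z - φ j z‖) (A : ι → ℝ) :
    ∫ z, ⨆ i, (A i + (∫ y, f i y ∂ν - f i z)) ∂ν
      ≤ ∫ p, ⨆ i, (A i + 2 * √(Real.pi / 2) * L * inner ℝ (φ i p.1) p.2)
          ∂(ν.prod (stdGaussian E)) := by
  have e1 : Integrable (fun z => ⨆ i, (A i / 2 + f i z)) ν :=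
    integrable_iSup_of_finite (fun i => by fun_prop) fun i => (integrable_const _).add (hf i)
  have e2 : Integrable (fun z => ⨆ i, (A i / 2 - f i z)) ν :=
    integrable_iSup_of_finite (fun i => by fun_prop) fun i => (integrable_const _).sub (hf i)
  have e3 : Integrable (fun z => ⨆ i, (A i + (∫ y, f i y ∂ν - f i z))) ν :=
    integrable_iSup_of_finite (fun i => by fun_prop) fun i =>
      (integrable_const _).add ((integrable_const _).sub (hf i))
  have e4 : Integrable (fun p : Ω × E => ⨆ i, (A i + 2 * √(Real.pi / 2) * L *
      inner ℝ (φ i p.1) p.2)) (ν.prod (stdGaussian E)) := by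
    refine integrable_iSup_of_finite (fun i => by fun_prop) fun i => ?_
    refine (integrable_const _).add (Integrable.const_mul ?_ _)
    have hg : Integrable (fun p : Ω × E => M i * ‖p.2‖) (ν.prod (stdGaussian E)) :=
      ((IsGaussian.integrable_id (μ := stdGaussian E)).norm.comp_snd ν).const_mul (M i)
    refine hg.mono' (Measurable.aestronglyMeasurable (by fun_prop))
      (Filter.Eventually.of_forall fun p => ?_)
    exact (norm_inner_le_norm _ _).trans (by gcongr; exact hM i p.1)
  rw [integral_prod _ e4]
  -- The offset is halved between an independent copy `y`, carrying `+f`, and `z`, carrying `-f`.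
  -- After integration both terms may be read at the same point, which is the form needed by
  -- `iSup_add_iSup_sub_le`; its factor 2 restores the full offset.
  calc _ ≤ ∫ z, ((∫ y, ⨆ i, (A i / 2 + f i y) ∂ν) + ⨆ i, (A i / 2 - f i z)) ∂ν := by
        refine integral_mono e3 ((integrable_const _).add e2) fun z => ciSup_le fun i => ?_
        have p1 := le_iSup_of_finite (fun i => A i / 2 - f i z) i
        have p2 : A i / 2 + ∫ y, f i y ∂ν ≤ ∫ y, ⨆ i, (A i / 2 + f i y) ∂ν := by
          have := integral_mono ((integrable_const (A i / 2)).add (hf i)) e1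
            fun y => le_iSup_of_finite (fun i => A i / 2 + f i y) i
          simpa [integral_add (integrable_const (A i / 2)) (hf i)] using this
        simp only at p1 ⊢
        linarith
    _ = ∫ z, ((⨆ i, (A i / 2 + f i z)) + ⨆ i, (A i / 2 - f i z)) ∂ν := by
        rw [integral_add (integrable_const _) e2, integral_add e1 e2]
        simp
    _ ≤ _ := by
        refine integral_mono (e1.add e2) e4.integral_prod_left fun z => ?_
        refine (iSup_add_iSup_sub_le fun i j => hL i j z).trans_eq ?_
        rw [← integral_const_mul]
        refine integral_congr_ae (Filter.Eventually.of_forall fun g => ?_)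
        simp only
        rw [Real.mul_iSup_of_nonneg (by norm_num)]
        congr 1; ext i; ring

end Gaussian


/-! ### McDiarmid's inequality. -/

section BoundedDifferences

variable {Ω : Type*} [MeasurableSpace Ω]

/-- Hoeffding's lemma: oscillation at most `c` confines `f` to an interval of length `c` starting at
its infimum, hence the sub-Gaussian parameter `(c / 2) ^ 2`. -/
theorem integral_exp_le_of_osc (m : Measure Ω) [IsProbabilityMeasure m] {f : Ω → ℝ} {c : ℝ}
    (hf : Measurable f) (hc : ∀ x y, f x - f y ≤ c) (s : ℝ) :
    ∫ x, Real.exp (s * f x) ∂m ≤ Real.exp (s * ∫ x, f x ∂m + s ^ 2 * c ^ 2 / 8) := by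
  have hne : Nonempty Ω := nonempty_of_isProbabilityMeasure m
  obtain ⟨x₀⟩ := hne
  have hbdd : BddBelow (Set.range f) := ⟨f x₀ - c, by
    rintro _ ⟨y, rfl⟩; linarith [hc x₀ y]⟩
  have hIcc : ∀ x, f x ∈ Set.Icc (⨅ y, f y) ((⨅ y, f y) + c) := fun x => by
    refine ⟨ciInf_le hbdd x, ?_⟩
    have : Nonempty Ω := ⟨x₀⟩
    have : f x - c ≤ ⨅ y, f y := le_ciInf fun y => by linarith [hc x y]
    linarith
  have h := (hasSubgaussianMGF_of_mem_Icc (μ := m) hf.aemeasurable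
    (Filter.Eventually.of_forall hIcc)).mgf_le s
  have e : (((‖(⨅ y, f y) + c - ⨅ y, f y‖₊ / 2) ^ 2 : NNReal) : ℝ) * s ^ 2 / 2
      = s ^ 2 * c ^ 2 / 8 := by
    simp only [add_sub_cancel_left, NNReal.coe_pow, NNReal.coe_div, coe_nnnorm, NNReal.coe_ofNat,
      div_pow, Real.norm_eq_abs, sq_abs]
    ring
  rw [e, mgf] at h
  have e2 : ∀ x, Real.exp (s * f x)
      = Real.exp (s * ∫ y, f y ∂m) * Real.exp (s * (f x - ∫ y, f y ∂m)) := fun x => by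
    rw [← Real.exp_add]; ring_nf
  simp_rw [e2]
  rw [integral_const_mul, Real.exp_add]
  gcongr

variable (m : Measure Ω) [IsProbabilityMeasure m]

/-- McDiarmid's inequality, exponential moment form. -/
theorem integral_exp_le_of_boundedDifferences {T : ℕ} {F : (Fin T → Ω) → ℝ} {c M : ℝ}
    (hF : Measurable F) (hM : ∀ x, |F x| ≤ M)
    (hc : ∀ x t a b, F (Function.update x t a) - F (Function.update x t b) ≤ c) (s : ℝ) :
    ∫ x, Real.exp (s * F x) ∂(Measure.pi fun _ : Fin T => m)
      ≤ Real.exp (s * (∫ x, F x ∂(Measure.pi fun _ : Fin T => m)) + T * (s ^ 2 * c ^ 2 / 8)) := by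
  induction T with
  | zero =>
    have h0 : ∀ x : Fin 0 → Ω, F x = F Fin.elim0 := fun x => congrArg F (Subsingleton.elim _ _)
    simp [h0]
  | succ k ih =>
    have hcons : Measurable fun p : Ω × (Fin k → Ω) => (Fin.cons p.1 p.2 : Fin (k + 1) → Ω) :=
      (measurePreserving_cons m k).measurable
    have hFc : Measurable fun p : Ω × (Fin k → Ω) => F (Fin.cons p.1 p.2) := hF.comp hcons
    have i1 : Integrable (fun p : Ω × (Fin k → Ω) => F (Fin.cons p.1 p.2))
        (m.prod (Measure.pi fun _ => m)) :=
      .of_bound hFc.aestronglyMeasurable M (Filter.Eventually.of_forall fun p => hM _)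
    have i2 : Integrable (fun p : Ω × (Fin k → Ω) => Real.exp (s * F (Fin.cons p.1 p.2)))
        (m.prod (Measure.pi fun _ => m)) := by
      refine .of_bound (hFc.const_mul s).exp.aestronglyMeasurable (Real.exp (|s| * M))
        (Filter.Eventually.of_forall fun p => ?_)
      rw [Real.norm_eq_abs, Real.abs_exp]
      refine Real.exp_le_exp.2 ((le_abs_self _).trans ?_)
      rw [abs_mul]
      gcongr
      exact hM _
    have hsec : ∀ z : Fin k → Ω, Integrable (fun x => F (Fin.cons x z)) m := fun z =>
      .of_bound (hFc.comp (measurable_prodMk_right (y := z))).aestronglyMeasurable M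
        (Filter.Eventually.of_forall fun p => hM _)
    -- Averaging out the first coordinate preserves bounded differences in the others, so the
    -- induction hypothesis applies to `G`; Hoeffding's lemma in the first coordinate costs one
    -- factor `exp (s ^ 2 * c ^ 2 / 8)`.
    let G : (Fin k → Ω) → ℝ := fun z => ∫ x, F (Fin.cons x z) ∂m
    have hG : Measurable G := by
      have : StronglyMeasurable fun p : (Fin k → Ω) × Ω => F (Fin.cons p.2 p.1) :=
        (hFc.comp measurable_swap).stronglyMeasurable
      exact this.integral_prod_right.measurable
    have hGM : ∀ z, |G z| ≤ M := fun z => by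
      have := norm_integral_le_of_norm_le_const (μ := m) (f := fun x => F (Fin.cons x z)) (C := M)
        (Filter.Eventually.of_forall fun x => hM _)
      simpa using this
    have hGc : ∀ z t a b, G (Function.update z t a) - G (Function.update z t b) ≤ c := by
      intro z t a b
      simp only [G]
      rw [← integral_sub (hsec _) (hsec _)]
      refine (integral_mono ((hsec _).sub (hsec _)) (integrable_const c) fun x => ?_).trans_eq
        (by simp)
      have := hc (Fin.cons x z) t.succ a b
      rwa [← Fin.cons_update, ← Fin.cons_update] at this
    rw [integral_pi_cons, integral_pi_cons, integral_prod_symm _ i2, integral_prod_symm _ i1]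
    calc _ ≤ ∫ z, Real.exp (s * G z) * Real.exp (s ^ 2 * c ^ 2 / 8)
          ∂(Measure.pi fun _ : Fin k => m) := by
          refine integral_mono i2.integral_prod_right (Integrable.mul_const ?_ _) fun z => ?_
          · refine .of_bound (by fun_prop) (Real.exp (|s| * M))
              (Filter.Eventually.of_forall fun p => ?_)
            rw [Real.norm_eq_abs, Real.abs_exp]
            refine Real.exp_le_exp.2 ((le_abs_self _).trans ?_)
            rw [abs_mul]
            gcongr
            exact hGM _
          · rw [← Real.exp_add]
            refine integral_exp_le_of_osc m (hFc.comp (measurable_prodMk_right (y := z)))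
              (fun x y => ?_) s
            have := hc (Fin.cons x z) 0 x y
            rwa [Fin.update_cons_zero, Fin.update_cons_zero] at this
      _ ≤ Real.exp (s * (∫ z, G z ∂(Measure.pi fun _ : Fin k => m)) + k * (s ^ 2 * c ^ 2 / 8))
          * Real.exp (s ^ 2 * c ^ 2 / 8) := by
          rw [integral_mul_const]
          gcongr
          exact ih hG hGM hGc
      _ = _ := by
          rw [← Real.exp_add]
          congr 1
          push_cast
          ring

/-- McDiarmid's inequality. -/
theorem measure_ge_le_of_boundedDifferences {T : ℕ} {F : (Fin T → Ω) → ℝ} {c M ε : ℝ}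
    (hF : Measurable F) (hM : ∀ x, |F x| ≤ M) (hT : 0 < T) (hc0 : 0 < c) (hε : 0 ≤ ε)
    (hc : ∀ x t a b, F (Function.update x t a) - F (Function.update x t b) ≤ c) :
    (Measure.pi fun _ : Fin T => m).real
        {x | (∫ y, F y ∂(Measure.pi fun _ : Fin T => m)) + ε ≤ F x}
      ≤ Real.exp (-2 * ε ^ 2 / (T * c ^ 2)) := by
  set E := ∫ y, F y ∂(Measure.pi fun _ : Fin T => m) with hE
  have hT' : (0 : ℝ) < T := by exact_mod_cast hT
  -- The minimizer of `T * s ^ 2 * c ^ 2 / 8 - s * ε` in Chernoff's bound.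
  set s := 4 * ε / (T * c ^ 2) with hs
  have hs0 : 0 ≤ s := by positivity
  have hint : Integrable (fun x => Real.exp (s * F x)) (Measure.pi fun _ : Fin T => m) := by
    refine .of_bound (by fun_prop) (Real.exp (|s| * M))
      (Filter.Eventually.of_forall fun p => ?_)
    rw [Real.norm_eq_abs, Real.abs_exp]
    refine Real.exp_le_exp.2 ((le_abs_self _).trans ?_)
    rw [abs_mul]
    gcongr
    exact hM _
  have h1 := mul_meas_ge_le_integral_of_nonneg
    (Filter.Eventually.of_forall fun x => (Real.exp_pos (s * F x)).le) hint
    (Real.exp (s * (E + ε)))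
  have h2 := integral_exp_le_of_boundedDifferences m hF hM hc s
  have h3 : (Measure.pi fun _ : Fin T => m).real {x | E + ε ≤ F x}
      ≤ (Measure.pi fun _ : Fin T => m).real
        {x | Real.exp (s * (E + ε)) ≤ Real.exp (s * F x)} := by
    refine measureReal_mono fun x hx => ?_
    exact Real.exp_le_exp.2 (mul_le_mul_of_nonneg_left hx hs0)
  have h4 : Real.exp (s * (E + ε)) * (Measure.pi fun _ : Fin T => m).real {x | E + ε ≤ F x}
      ≤ Real.exp (s * (E + ε)) * Real.exp (-2 * ε ^ 2 / (T * c ^ 2)) := by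
    refine (mul_le_mul_of_nonneg_left h3 (Real.exp_pos _).le).trans (h1.trans (h2.trans_eq ?_))
    rw [← Real.exp_add]
    congr 1
    rw [← hE, hs]
    field_simp
    ring
  exact le_of_mul_le_mul_left h4 (Real.exp_pos _)

end BoundedDifferences


/-! ### Cauchy–Schwarz for bilinear forms and Frobenius norms. -/

section LinearAlgebra

variable {α β : Type*} [Fintype α] [Fintype β]

theorem abs_dotProduct_le (x y : α → ℝ) : |x ⬝ᵥ y| ≤ √(∑ i, x i ^ 2) * √(∑ i, y i ^ 2) := by
  refine abs_le_of_sq_le_sq ?_ (by positivity)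
  rw [mul_pow, Real.sq_sqrt (by positivity), Real.sq_sqrt (by positivity)]
  exact Finset.sum_mul_sq_le_sq_mul_sq _ _ _

theorem dotProduct_mulVec_eq_sum (M : Matrix α β ℝ) (x : α → ℝ) (y : β → ℝ) :
    x ⬝ᵥ (M *ᵥ y) = ∑ p : α × β, M p.1 p.2 * (x p.1 * y p.2) := by
  rw [Fintype.sum_prod_type]
  simp only [dotProduct, Matrix.mulVec, Finset.mul_sum]
  exact Finset.sum_congr rfl fun i _ => Finset.sum_congr rfl fun j _ => by ring

theorem sum_sq_mul_eq (x : α → ℝ) (y : β → ℝ) :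
    ∑ p : α × β, (x p.1 * y p.2) ^ 2 = (∑ i, x i ^ 2) * ∑ j, y j ^ 2 := by
  rw [Fintype.sum_prod_type, Finset.sum_mul_sum]
  simp only [mul_pow]

theorem abs_dotProduct_mulVec_le (M : Matrix α β ℝ) (x : α → ℝ) (y : β → ℝ) :
    |x ⬝ᵥ (M *ᵥ y)|
      ≤ √(∑ p : α × β, M p.1 p.2 ^ 2) * (√(∑ i, x i ^ 2) * √(∑ j, y j ^ 2)) := by
  rw [dotProduct_mulVec_eq_sum]
  refine (abs_dotProduct_le (fun p : α × β => M p.1 p.2) fun p => x p.1 * y p.2).trans_eq ?_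
  rw [sum_sq_mul_eq, Real.sqrt_mul (by positivity)]

theorem exists_eq_transpose_mul_self {d : ℕ} {D : Matrix (Fin d) (Fin d) ℝ} (hD : D.PosSemidef) :
    ∃ B : Matrix (Fin d) (Fin d) ℝ, D = Bᵀ * B := by
  open scoped MatrixOrder Matrix.Norms.L2Operator in
  obtain ⟨B, hB⟩ := CStarAlgebra.nonneg_iff_eq_star_mul_self.1 hD.nonneg
  exact ⟨B, by simpa [Matrix.star_eq_conjTranspose] using hB⟩

theorem trace_transpose_mul_self_eq {d : ℕ} (B : Matrix (Fin d) (Fin d) ℝ) :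
    (Bᵀ * B).trace = ∑ p : Fin d × Fin d, B p.1 p.2 ^ 2 := by
  rw [Fintype.sum_prod_type, Finset.sum_comm]
  simp [Matrix.trace, Matrix.mul_apply, sq]

theorem sum_sq_mulVec_le (M : Matrix α β ℝ) (x : β → ℝ) :
    ∑ i, (M *ᵥ x) i ^ 2 ≤ (∑ p : α × β, M p.1 p.2 ^ 2) * ∑ j, x j ^ 2 := by
  rw [Fintype.sum_prod_type, Finset.sum_mul]
  exact Finset.sum_le_sum fun i _ => Finset.sum_mul_sq_le_sq_mul_sq _ _ _

/-- With `D = BᵀB`, Cauchy–Schwarz on the columns of `B` gives `D i j ^ 2 ≤ D i i * D j j`; summing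
yields the square of the trace. -/
theorem sqrt_sum_sq_le_trace {d : ℕ} {D : Matrix (Fin d) (Fin d) ℝ} (hD : D.PosSemidef) :
    √(∑ p : Fin d × Fin d, D p.1 p.2 ^ 2) ≤ D.trace := by
  obtain ⟨B, rfl⟩ := exists_eq_transpose_mul_self hD
  rw [trace_transpose_mul_self_eq]
  refine Real.sqrt_le_iff.2 ⟨by positivity, ?_⟩
  have h : ∀ p : Fin d × Fin d, (Bᵀ * B) p.1 p.2 ^ 2
      ≤ (∑ k, B k p.1 ^ 2) * ∑ k, B k p.2 ^ 2 := fun p => by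
    rw [Matrix.mul_apply]
    exact Finset.sum_mul_sq_le_sq_mul_sq _ _ _
  refine (Finset.sum_le_sum fun p _ => h p).trans_eq ?_
  rw [Fintype.sum_prod_type, Fintype.sum_prod_type, Finset.sum_comm (f := fun i j => B i j ^ 2), sq,
    Finset.sum_mul_sum]

end LinearAlgebra

/-! ### Ridge regression in dual form and its dependence on the kernel matrix. -/

section Ridge

variable {d : ℕ} {𝒳 : Set (EuclideanSpace ℝ (Fin d))} {𝒴 : Set ℝ} {n : ℕ}

/-- The matrix whose rows are the inputs of the dataset. -/
def inputs (Z : Fin n → Point 𝒳 𝒴) : Matrix (Fin n) (Fin d) ℝ :=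
  Matrix.of fun i => WithLp.ofLp (Z i).1.1

/-- The vector of the labels of the dataset. -/
def labels (Z : Fin n → Point 𝒳 𝒴) : Fin n → ℝ := fun i => (Z i).2.1

/-- The regularized kernel matrix of the dataset. -/
def kernelMatrix (D : Matrix (Fin d) (Fin d) ℝ) (Z : Fin n → Point 𝒳 𝒴) :
    Matrix (Fin n) (Fin n) ℝ :=
  inputs Z * D * (inputs Z)ᵀ + (n : ℝ) • (1 : Matrix (Fin n) (Fin n) ℝ)

/-- The coefficients of the dual form of ridge regression. -/
noncomputable def dualCoeff (D : Matrix (Fin d) (Fin d) ℝ) (Z : Fin n → Point 𝒳 𝒴) : Fin n → ℝ :=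
  (kernelMatrix D Z)⁻¹ *ᵥ labels Z

variable (Z : Fin n → Point 𝒳 𝒴) {D : Matrix (Fin d) (Fin d) ℝ}

theorem posDef_kernelMatrix (hn : 0 < n) (hD : D.PosSemidef) : (kernelMatrix D Z).PosDef := by
  have hn0 : (0 : ℝ) < n := by positivity
  refine Matrix.PosDef.posSemidef_add ?_ (Matrix.PosDef.one.smul hn0)
  simpa using hD.mul_mul_conjTranspose_same (inputs Z)

theorem kernelMatrix_mulVec_dualCoeff (hn : 0 < n) (hD : D.PosSemidef) :
    kernelMatrix D Z *ᵥ dualCoeff D Z = labels Z := by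
  rw [dualCoeff, Matrix.mulVec_mulVec, Matrix.mul_nonsing_inv _
    ((Matrix.isUnit_iff_isUnit_det _).1 (posDef_kernelMatrix Z hn hD).isUnit), Matrix.one_mulVec]

theorem kernelMatrix_mulVec (a : Fin n → ℝ) :
    kernelMatrix D Z *ᵥ a = inputs Z *ᵥ (D *ᵥ ((inputs Z)ᵀ *ᵥ a)) + (n : ℝ) • a := by
  rw [kernelMatrix, Matrix.add_mulVec, Matrix.smul_mulVec, Matrix.one_mulVec,
    ← Matrix.mulVec_mulVec, ← Matrix.mulVec_mulVec]

theorem dotProduct_kernelMatrix_mulVec (a b : Fin n → ℝ) :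
    b ⬝ᵥ (kernelMatrix D Z *ᵥ a)
      = ((inputs Z)ᵀ *ᵥ b) ⬝ᵥ (D *ᵥ ((inputs Z)ᵀ *ᵥ a)) + (n : ℝ) * (b ⬝ᵥ a) := by
  rw [kernelMatrix_mulVec, dotProduct_add, dotProduct_smul, smul_eq_mul, Matrix.dotProduct_mulVec,
    ← Matrix.mulVec_transpose]

theorem pointLoss_eq (w : Fin d → ℝ) (i : Fin n) :
    pointLoss w (Z i) = ((inputs Z *ᵥ w) i - labels Z i) ^ 2 := by
  rw [pointLoss, sqLoss, dotProduct_comm]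
  rfl

/-- On `Ran D` the penalty of `D v` is `vᵀ D v`, since `D D† D = D`. Expanding the objective around
`D u`, the linear terms cancel by the kernel equation, so `D u` is a minimizer, and uniqueness
identifies it with the chosen one. The pseudoinverse plays no part from here on. -/
theorem ridge_eq (hn : 0 < n) (hD : D.PosSemidef) :
    ridge D Z = D *ᵥ ((inputs Z)ᵀ *ᵥ dualCoeff D Z) := by
  set u := (inputs Z)ᵀ *ᵥ dualCoeff D Z with hu
  have hn0 : (0 : ℝ) < n := by positivity
  have hsymm : Dᵀ = D := by simpa [Matrix.IsHermitian] using hD.isHermitian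
  have hb : ∀ u v : Fin d → ℝ, (D *ᵥ u) ⬝ᵥ v = u ⬝ᵥ (D *ᵥ v) := by
    intro u v
    rw [Matrix.dotProduct_mulVec, ← Matrix.mulVec_transpose, hsymm]
  have hpen : ∀ v : Fin d → ℝ, (D *ᵥ v) ⬝ᵥ (pinv D *ᵥ (D *ᵥ v)) = v ⬝ᵥ (D *ᵥ v) := by
    intro v
    rw [hb, Matrix.mulVec_mulVec, Matrix.mulVec_mulVec,
      (isMoorePenrose_pinv hD.isHermitian).mul_mul_self]
  have hr : ∀ i, (inputs Z *ᵥ (D *ᵥ u)) i - labels Z i = -(n : ℝ) * dualCoeff D Z i := by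
    intro i
    have := congrFun (kernelMatrix_mulVec_dualCoeff Z hn hD) i
    rw [kernelMatrix_mulVec, ← hu] at this
    simp only [Pi.add_apply, Pi.smul_apply, smul_eq_mul] at this
    linarith
  have hcross : ∀ v : Fin d → ℝ, ∑ i, dualCoeff D Z i * (inputs Z *ᵥ (D *ᵥ v)) i
      = u ⬝ᵥ (D *ᵥ v) := by
    intro v
    change dualCoeff D Z ⬝ᵥ (inputs Z *ᵥ (D *ᵥ v)) = _
    rw [Matrix.dotProduct_mulVec, ← Matrix.mulVec_transpose]
  have hexp : ∀ v : Fin d → ℝ, ridgeObjective D Z (D *ᵥ (u + v)) = ridgeObjective D Z (D *ᵥ u)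
      + (1 / (n : ℝ)) * ∑ i, (inputs Z *ᵥ (D *ᵥ v)) i ^ 2 + v ⬝ᵥ (D *ᵥ v) := by
    intro v
    have hvu : v ⬝ᵥ (D *ᵥ u) = u ⬝ᵥ (D *ᵥ v) := by rw [← hb, dotProduct_comm]
    have hsum : ∑ i, ((inputs Z *ᵥ (D *ᵥ u + D *ᵥ v)) i - labels Z i) ^ 2
        = ∑ i, ((inputs Z *ᵥ (D *ᵥ u)) i - labels Z i) ^ 2 - 2 * (n : ℝ) * (u ⬝ᵥ (D *ᵥ v))
          + ∑ i, (inputs Z *ᵥ (D *ᵥ v)) i ^ 2 := by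
      rw [← hcross, Finset.mul_sum, ← Finset.sum_sub_distrib, ← Finset.sum_add_distrib]
      refine Finset.sum_congr rfl fun i _ => ?_
      rw [Matrix.mulVec_add, Pi.add_apply]
      linear_combination (2 * (inputs Z *ᵥ (D *ᵥ v)) i) * hr i
    simp only [ridgeObjective, empRisk, pointLoss_eq]
    rw [hpen, hpen, Matrix.mulVec_add, hsum]
    simp only [add_dotProduct, dotProduct_add, hvu]
    field_simp
    ring
  have hsol : IsRidgeSolution D Z (D *ᵥ u) := by
    refine ⟨⟨u, rfl⟩, ?_⟩
    rintro _ ⟨v, rfl⟩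
    have h := hexp (v - u)
    rw [add_sub_cancel] at h
    have h3 : 0 ≤ (1 / (n : ℝ)) * ∑ i, (inputs Z *ᵥ (D *ᵥ (v - u))) i ^ 2 := by positivity
    have h4 : 0 ≤ (v - u) ⬝ᵥ (D *ᵥ (v - u)) := by
      simpa using hD.dotProduct_mulVec_nonneg (v - u)
    rw [Matrix.mulVecLin_apply]
    linarith
  obtain ⟨w, -, hw⟩ := existsUnique_isRidgeSolution hn hD Z
  exact (hw _ (Classical.epsilon_spec ⟨_, hsol⟩)).trans (hw _ hsol).symm

/-- The residual vector is `-n` times the dual coefficients. -/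
theorem empRisk_ridge (hn : 0 < n) (hD : D.PosSemidef) :
    empRisk Z (ridge D Z) = n * ∑ i, dualCoeff D Z i ^ 2 := by
  have hn0 : (0 : ℝ) < n := by positivity
  have hr : ∀ i, (inputs Z *ᵥ ridge D Z) i - labels Z i = -(n : ℝ) * dualCoeff D Z i := by
    intro i
    have := congrFun (kernelMatrix_mulVec_dualCoeff Z hn hD) i
    rw [kernelMatrix_mulVec, ← ridge_eq Z hn hD] at this
    simp only [Pi.add_apply, Pi.smul_apply, smul_eq_mul] at this
    linarith
  simp only [empRisk, pointLoss_eq, hr, mul_pow, neg_sq, ← Finset.mul_sum]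
  field_simp

theorem sum_sq_labels_le (h𝒴 : 𝒴 ⊆ Set.Icc 0 1) : ∑ i, labels Z i ^ 2 ≤ n := by
  have : ∀ i, labels Z i ^ 2 ≤ 1 := fun i => by
    have := h𝒴 (Z i).2.2
    exact pow_le_one₀ this.1 this.2
  simpa using Finset.sum_le_sum fun i (_ : i ∈ Finset.univ) => this i

theorem dotProduct_dualCoeff_labels (hn : 0 < n) (hD : D.PosSemidef) :
    dualCoeff D Z ⬝ᵥ labels Z = ((inputs Z)ᵀ *ᵥ dualCoeff D Z) ⬝ᵥ
      (D *ᵥ ((inputs Z)ᵀ *ᵥ dualCoeff D Z)) + n * ∑ i, dualCoeff D Z i ^ 2 := by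
  conv_lhs => rw [← kernelMatrix_mulVec_dualCoeff Z hn hD]
  rw [dotProduct_kernelMatrix_mulVec]
  simp only [dotProduct, sq]

/-- Since the kernel matrix dominates `n • 1`, `n ‖a‖² ≤ a ⬝ y`, and `a ⬝ y` is controlled by
expanding `‖n a - y‖² ≥ 0`. The left side is the training error. -/
theorem sum_sq_dualCoeff_le (h𝒴 : 𝒴 ⊆ Set.Icc 0 1) (hn : 0 < n) (hD : D.PosSemidef) :
    n * ∑ i, dualCoeff D Z i ^ 2 ≤ 1 := by
  have hn0 : (0 : ℝ) < n := by positivity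
  have h1 := dotProduct_dualCoeff_labels Z hn hD
  have h2 := hD.dotProduct_mulVec_nonneg ((inputs Z)ᵀ *ᵥ dualCoeff D Z)
  rw [star_trivial] at h2
  have h3 := sum_sq_labels_le Z h𝒴
  have h4 : 0 ≤ ∑ i, (n * dualCoeff D Z i - labels Z i) ^ 2 := by positivity
  have h5 : ∑ i, (n * dualCoeff D Z i - labels Z i) ^ 2 = n ^ 2 * ∑ i, dualCoeff D Z i ^ 2
      - 2 * n * (dualCoeff D Z ⬝ᵥ labels Z) + ∑ i, labels Z i ^ 2 := by
    simp only [dotProduct, Finset.mul_sum, ← Finset.sum_sub_distrib, ← Finset.sum_add_distrib]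
    exact Finset.sum_congr rfl fun i _ => by ring
  have h6 : (n : ℝ) * (n * ∑ i, dualCoeff D Z i ^ 2) ≤ n * 1 := by nlinarith
  exact le_of_mul_le_mul_left h6 hn0

theorem empRisk_ridge_mem_Icc (h𝒴 : 𝒴 ⊆ Set.Icc 0 1) (hn : 0 < n) (hD : D.PosSemidef) :
    empRisk Z (ridge D Z) ∈ Set.Icc 0 1 := by
  rw [empRisk_ridge Z hn hD]
  exact ⟨by positivity, sum_sq_dualCoeff_le Z h𝒴 hn hD⟩

/-- Confines all ridge solutions for a given `D` to the image of one fixed ball, over which risks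
can be compared uniformly. With `v = B u`, `‖v‖² = a ⬝ y - n ‖a‖²`, and expanding `‖2 n a - y‖² ≥ 0`
bounds this by `‖y‖² / (4 n)`. -/
theorem exists_ridge_eq (h𝒴 : 𝒴 ⊆ Set.Icc 0 1) (hn : 0 < n) {B : Matrix (Fin d) (Fin d) ℝ}
    (hB : D = Bᵀ * B) : ∃ v : Fin d → ℝ, ridge D Z = Bᵀ *ᵥ v ∧ ∑ k, v k ^ 2 ≤ 1 := by
  have hD : D.PosSemidef := by
    rw [hB]; simpa using Matrix.posSemidef_conjTranspose_mul_self B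
  set u := (inputs Z)ᵀ *ᵥ dualCoeff D Z with hu
  refine ⟨B *ᵥ u, ?_, ?_⟩
  · rw [ridge_eq Z hn hD, hB, ← Matrix.mulVec_mulVec, ← hB]
  · have hn0 : (0 : ℝ) < n := by positivity
    have h1 := dotProduct_dualCoeff_labels Z hn hD
    rw [← hu] at h1
    have h3 := sum_sq_labels_le Z h𝒴
    have h4 : 0 ≤ ∑ i, (2 * n * dualCoeff D Z i - labels Z i) ^ 2 := by positivity
    have h5 : ∑ i, (2 * n * dualCoeff D Z i - labels Z i) ^ 2
        = 4 * n * (n * ∑ i, dualCoeff D Z i ^ 2)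
        - 4 * n * (dualCoeff D Z ⬝ᵥ labels Z) + ∑ i, labels Z i ^ 2 := by
      simp only [dotProduct, Finset.mul_sum, ← Finset.sum_sub_distrib, ← Finset.sum_add_distrib]
      exact Finset.sum_congr rfl fun i _ => by ring
    have h6 : u ⬝ᵥ (D *ᵥ u) = ∑ k, (B *ᵥ u) k ^ 2 := by
      rw [hB, ← Matrix.mulVec_mulVec, Matrix.dotProduct_mulVec, Matrix.vecMul_transpose]
      simp only [dotProduct, sq]
    rw [← h6]
    have h7 : (n : ℝ) * (u ⬝ᵥ (D *ᵥ u)) ≤ n * 1 := by nlinarith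
    exact le_of_mul_le_mul_left h7 hn0

/-- The closed form is continuous in the data because the kernel matrix is invertible everywhere. -/
theorem measurable_ridge (hn : 0 < n) (hD : D.PosSemidef) :
    Measurable fun Z : Fin n → Point 𝒳 𝒴 => ridge D Z := by
  have hX : Continuous fun Z : Fin n → Point 𝒳 𝒴 => inputs Z := by
    refine continuous_pi fun i => continuous_pi fun j => ?_
    simp only [inputs, Matrix.of_apply]
    fun_prop
  have hy : Continuous fun Z : Fin n → Point 𝒳 𝒴 => labels Z := by
    unfold labels; fun_prop
  have hK : Continuous fun Z : Fin n → Point 𝒳 𝒴 => kernelMatrix D Z :=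
    ((hX.matrix_mul continuous_const).matrix_mul hX.matrix_transpose).add continuous_const
  have hinv : Continuous fun Z : Fin n → Point 𝒳 𝒴 => (kernelMatrix D Z)⁻¹ := by
    simp only [Matrix.inv_def, Ring.inverse_eq_inv']
    exact (hK.matrix_det.inv₀ fun Z => (posDef_kernelMatrix Z hn hD).det_pos.ne').smul
      hK.matrix_adjugate
  have : Continuous fun Z : Fin n → Point 𝒳 𝒴 => ridge D Z := by
    simp only [ridge_eq _ hn hD]
    exact continuous_const.matrix_mulVec
      (hX.matrix_transpose.matrix_mulVec (hinv.matrix_mulVec hy))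
  exact this.measurable

/-- The coefficient of the entry `(a, b)` of `D` in the normalized kernel matrix. -/
noncomputable def gramCoeff (Z : Fin n → Point 𝒳 𝒴) (p : Fin d × Fin d) :
    EuclideanSpace ℝ (Fin n × Fin n) :=
  WithLp.toLp 2 fun q => (1 / (n : ℝ)) * (inputs Z q.1 p.1 * inputs Z q.2 p.2)

/-- The normalized kernel matrix, a linear function of `D`. -/
noncomputable def gram (D : Matrix (Fin d) (Fin d) ℝ) (Z : Fin n → Point 𝒳 𝒴) :
    EuclideanSpace ℝ (Fin n × Fin n) :=
  ∑ p : Fin d × Fin d, D p.1 p.2 • gramCoeff Z p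

theorem gram_apply (D : Matrix (Fin d) (Fin d) ℝ) (q : Fin n × Fin n) :
    gram D Z q = (1 / (n : ℝ)) * (inputs Z * D * (inputs Z)ᵀ) q.1 q.2 := by
  have h : (inputs Z * D * (inputs Z)ᵀ) q.1 q.2
      = ∑ p : Fin d × Fin d, D p.1 p.2 * (inputs Z q.1 p.1 * inputs Z q.2 p.2) := by
    rw [Fintype.sum_prod_type, Finset.sum_comm]
    simp only [Matrix.mul_apply, Matrix.transpose_apply, Finset.sum_mul]
    exact Finset.sum_congr rfl fun i _ => Finset.sum_congr rfl fun j _ => by ring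
  rw [h, gram, Finset.mul_sum]
  simp only [WithLp.ofLp_sum, Finset.sum_apply, PiLp.smul_apply, smul_eq_mul, gramCoeff]
  exact Finset.sum_congr rfl fun i _ => by ring

theorem gram_sub (D D' : Matrix (Fin d) (Fin d) ℝ) : gram D Z - gram D' Z = gram (D - D') Z := by
  simp only [gram, ← Finset.sum_sub_distrib, ← sub_smul, Matrix.sub_apply]

theorem measurable_gramCoeff (p : Fin d × Fin d) :
    Measurable fun Z : Fin n → Point 𝒳 𝒴 => gramCoeff Z p := by
  refine Continuous.measurable ?_
  unfold gramCoeff inputs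
  simp only [Matrix.of_apply]
  fun_prop

theorem measurable_gram (D : Matrix (Fin d) (Fin d) ℝ) :
    Measurable fun Z : Fin n → Point 𝒳 𝒴 => gram D Z := by
  unfold gram
  exact Finset.measurable_sum _ fun p _ => Measurable.const_smul (measurable_gramCoeff p) (D p.1 p.2)

theorem sum_sq_norm_gramCoeff_le (h𝒳 : 𝒳 ⊆ Metric.closedBall 0 1) (hn : 0 < n) :
    ∑ p, ‖gramCoeff Z p‖ ^ 2 ≤ 1 := by
  have hn0 : (0 : ℝ) < n := by positivity
  have hx : ∀ i, ∑ a, inputs Z i a ^ 2 ≤ 1 := fun i => by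
    have := h𝒳 (Z i).1.2
    rw [mem_closedBall_zero_iff] at this
    have h2 := EuclideanSpace.real_norm_sq_eq (Z i).1.1
    have h3 : ‖(Z i).1.1‖ ^ 2 ≤ 1 := pow_le_one₀ (norm_nonneg _) this
    rw [h2] at h3
    exact h3
  simp only [EuclideanSpace.real_norm_sq_eq, gramCoeff]
  rw [Finset.sum_comm]
  have : ∀ q : Fin n × Fin n, ∑ p : Fin d × Fin d,
      ((1 / (n : ℝ)) * (inputs Z q.1 p.1 * inputs Z q.2 p.2)) ^ 2 ≤ (1 / (n : ℝ)) ^ 2 := fun q => by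
    simp only [mul_pow _ (inputs Z q.1 _ * inputs Z q.2 _), ← Finset.mul_sum]
    rw [sum_sq_mul_eq]
    have h1 := hx q.1
    have h2 := hx q.2
    have h3 : (∑ a, inputs Z q.1 a ^ 2) * ∑ a, inputs Z q.2 a ^ 2 ≤ 1 :=
      mul_le_one₀ h1 (by positivity) h2
    exact mul_le_of_le_one_right (by positivity) h3
  refine (Finset.sum_le_sum fun q _ => this q).trans_eq ?_
  simp
  field_simp

theorem norm_gram_le (h𝒳 : 𝒳 ⊆ Metric.closedBall 0 1) (hn : 0 < n)
    (D : Matrix (Fin d) (Fin d) ℝ) : ‖gram D Z‖ ≤ ∑ p : Fin d × Fin d, |D p.1 p.2| := by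
  refine (norm_sum_le _ _).trans (Finset.sum_le_sum fun p _ => ?_)
  have h1 : ‖gramCoeff Z p‖ ^ 2 ≤ 1 :=
    (Finset.single_le_sum (f := fun p => ‖gramCoeff Z p‖ ^ 2) (fun _ _ => sq_nonneg _)
      (Finset.mem_univ p)).trans (sum_sq_norm_gramCoeff_le Z h𝒳 hn)
  have h2 : ‖gramCoeff Z p‖ ≤ 1 := (sq_le_one_iff₀ (norm_nonneg _)).1 h1
  rw [norm_smul, Real.norm_eq_abs]
  exact mul_le_of_le_one_right (abs_nonneg _) h2

/-- The training error of ridge regression is a Lipschitz function of the kernel matrix. -/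
theorem abs_empRisk_ridge_sub_le (h𝒴 : 𝒴 ⊆ Set.Icc 0 1) (hn : 0 < n) (hD : D.PosSemidef)
    {D' : Matrix (Fin d) (Fin d) ℝ} (hD' : D'.PosSemidef) :
    |empRisk Z (ridge D Z) - empRisk Z (ridge D' Z)| ≤ 2 * ‖gram D Z - gram D' Z‖ := by
  have hn0 : (0 : ℝ) < n := by positivity
  set a := dualCoeff D Z with ha
  set a' := dualCoeff D' Z with ha'
  set Δ := ‖gram D Z - gram D' Z‖ with hΔ
  set M := inputs Z * (D - D') * (inputs Z)ᵀ with hM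
  have hΔM : √(∑ q : Fin n × Fin n, M q.1 q.2 ^ 2) = n * Δ := by
    rw [hΔ, gram_sub, EuclideanSpace.norm_eq]
    simp only [gram_apply, Real.norm_eq_abs, sq_abs, mul_pow (1 / (n : ℝ)), ← Finset.mul_sum]
    rw [Real.sqrt_mul (by positivity), Real.sqrt_sq (by positivity)]
    field_simp
    rfl
  have hK : kernelMatrix D Z = kernelMatrix D' Z + M := by
    rw [kernelMatrix, kernelMatrix, hM, Matrix.mul_sub, Matrix.sub_mul]
    abel
  -- Resolvent identity: both coefficient vectors solve their kernel equation with the same labels.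
  have hdiff : kernelMatrix D Z *ᵥ (a - a') = -(M *ᵥ a') := by
    rw [Matrix.mulVec_sub, kernelMatrix_mulVec_dualCoeff Z hn hD, hK, Matrix.add_mulVec,
      kernelMatrix_mulVec_dualCoeff Z hn hD']
    abel
  set s := √(∑ i, (a - a') i ^ 2) with hs
  set s₁ := √(∑ i, a i ^ 2) with hs₁
  set s₂ := √(∑ i, a' i ^ 2) with hs₂
  have hss : s ^ 2 = ∑ i, (a - a') i ^ 2 := Real.sq_sqrt (by positivity)
  have hs1 : n * s₁ ^ 2 ≤ 1 := by
    rw [hs₁, Real.sq_sqrt (by positivity)]; exact sum_sq_dualCoeff_le Z h𝒴 hn hD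
  have hs2 : n * s₂ ^ 2 ≤ 1 := by
    rw [hs₂, Real.sq_sqrt (by positivity)]; exact sum_sq_dualCoeff_le Z h𝒴 hn hD'
  have hΔ0 : 0 ≤ Δ := norm_nonneg _
  have hs0 : 0 ≤ s := Real.sqrt_nonneg _
  have hs10 : 0 ≤ s₁ := Real.sqrt_nonneg _
  have hs20 : 0 ≤ s₂ := Real.sqrt_nonneg _
  -- Test `hdiff` against `a - a'`: the kernel matrix is at least `n • 1` on the left, and `M` has
  -- Frobenius norm `n * Δ` on the right.
  have h1 : n * s ^ 2 ≤ n * Δ * (s * s₂) := by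
    have e1 := dotProduct_kernelMatrix_mulVec (D := D) Z (a - a') (a - a')
    have e2 := hD.dotProduct_mulVec_nonneg ((inputs Z)ᵀ *ᵥ (a - a'))
    rw [star_trivial] at e2
    have e3 := abs_dotProduct_mulVec_le M (a - a') a'
    rw [hΔM] at e3
    have e4 : (a - a') ⬝ᵥ (a - a') = s ^ 2 := by rw [hss]; simp only [dotProduct, sq]
    rw [hdiff, dotProduct_neg, e4] at e1
    have := neg_abs_le ((a - a') ⬝ᵥ (M *ᵥ a'))
    linarith
  have h2 : s ≤ Δ * s₂ := by
    rcases hs0.eq_or_lt with h | h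
    · rw [← h]; positivity
    · have : (n * s) * s ≤ (n * s) * (Δ * s₂) := by linarith
      exact le_of_mul_le_mul_left this (by positivity)
  rw [empRisk_ridge Z hn hD, empRisk_ridge Z hn hD', ← mul_sub]
  have h3 : ∑ i, a i ^ 2 - ∑ i, a' i ^ 2 = (a - a') ⬝ᵥ a + (a - a') ⬝ᵥ a' := by
    simp only [dotProduct, ← Finset.sum_sub_distrib, ← Finset.sum_add_distrib, Pi.sub_apply]
    exact Finset.sum_congr rfl fun i _ => by ring
  rw [h3, abs_mul, abs_of_pos hn0]
  have h4 := (abs_add_le _ _).trans (add_le_add (abs_dotProduct_le (a - a') a)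
    (abs_dotProduct_le (a - a') a'))
  rw [← hs, ← hs₁, ← hs₂] at h4
  -- The Lipschitz constant 2: both training errors `n * s₁ ^ 2` and `n * s₂ ^ 2` are at most 1, and
  -- `2 * s₁ * s₂ ≤ s₁ ^ 2 + s₂ ^ 2`.
  have h5 : n * (s₂ * s₁ + s₂ * s₂) ≤ 2 := by nlinarith [sq_nonneg (s₁ - s₂)]
  calc _ ≤ n * (s * s₁ + s * s₂) := by gcongr
    _ ≤ n * (Δ * s₂ * s₁ + Δ * s₂ * s₂) := by gcongr
    _ = (n * (s₂ * s₁ + s₂ * s₂)) * Δ := by ring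
    _ ≤ 2 * Δ := by gcongr

end Ridge


/-! ### Generalization gap of ridge regression on a single task. -/

section Task

variable {d : ℕ} {𝒳 : Set (EuclideanSpace ℝ (Fin d))} {𝒴 : Set ℝ} {n : ℕ}

/-- The kernel that sends a task to itself. -/
noncomputable def taskKernel (𝒳 : Set (EuclideanSpace ℝ (Fin d))) (𝒴 : Set ℝ) :
    Kernel (ProbabilityMeasure (Point 𝒳 𝒴)) (Point 𝒳 𝒴) :=
  ⟨Subtype.val, measurable_subtype_coe⟩

instance : IsMarkovKernel (taskKernel 𝒳 𝒴) :=
  ⟨fun μ => inferInstanceAs (IsProbabilityMeasure (μ : Measure (Point 𝒳 𝒴)))⟩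

theorem sum_sq_input_le (h𝒳 : 𝒳 ⊆ Metric.closedBall 0 1) (x : 𝒳) : ∑ a, x.1 a ^ 2 ≤ 1 := by
  have h := h𝒳 x.2
  rw [mem_closedBall_zero_iff] at h
  rw [← EuclideanSpace.real_norm_sq_eq]
  exact pow_le_one₀ (norm_nonneg _) h

/-- The features of the input of a point, for a factor `B` of `D = Bᵀ B`. -/
def feature (B : Matrix (Fin d) (Fin d) ℝ) (z : Point 𝒳 𝒴) : Fin d → ℝ :=
  B *ᵥ WithLp.ofLp z.1.1

theorem continuous_feature (B : Matrix (Fin d) (Fin d) ℝ) :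
    Continuous (feature B : Point 𝒳 𝒴 → Fin d → ℝ) := by
  unfold feature
  exact continuous_const.matrix_mulVec (by fun_prop)

theorem measurable_feature_apply (B : Matrix (Fin d) (Fin d) ℝ) (k : Fin d) :
    Measurable fun z : Point 𝒳 𝒴 => feature B z k :=
  ((continuous_apply k).comp (continuous_feature B)).measurable

theorem sum_sq_feature_le (h𝒳 : 𝒳 ⊆ Metric.closedBall 0 1) {B : Matrix (Fin d) (Fin d) ℝ} {r : ℝ}
    (hr : (Bᵀ * B).trace ≤ r) (z : Point 𝒳 𝒴) : ∑ k, feature B z k ^ 2 ≤ r := by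
  refine (sum_sq_mulVec_le B _).trans (le_trans ?_ hr)
  rw [trace_transpose_mul_self_eq]
  exact mul_le_of_le_one_right (by positivity) (sum_sq_input_le h𝒳 z.1)

theorem label_mem (h𝒴 : 𝒴 ⊆ Set.Icc 0 1) (z : Point 𝒳 𝒴) : (z.2 : ℝ) ^ 2 ≤ 1 :=
  pow_le_one₀ (h𝒴 z.2.2).1 (h𝒴 z.2.2).2

theorem pointLoss_transpose_mulVec (B : Matrix (Fin d) (Fin d) ℝ) (v : Fin d → ℝ)
    (z : Point 𝒳 𝒴) : pointLoss (Bᵀ *ᵥ v) z = (v ⬝ᵥ feature B z - z.2) ^ 2 := by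
  rw [pointLoss, sqLoss, feature, Matrix.mulVec_transpose, Matrix.dotProduct_mulVec]

theorem pointLoss_expand (B : Matrix (Fin d) (Fin d) ℝ) (v : Fin d → ℝ) (z : Point 𝒳 𝒴) :
    pointLoss (Bᵀ *ᵥ v) z = ∑ p : Fin d × Fin d, v p.1 * v p.2 * (feature B z p.1 * feature B z p.2)
      - 2 * ∑ k, v k * (z.2 * feature B z k) + (z.2 : ℝ) ^ 2 := by
  have h1 : ∑ p : Fin d × Fin d, v p.1 * v p.2 * (feature B z p.1 * feature B z p.2)
      = (v ⬝ᵥ feature B z) ^ 2 := by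
    rw [sq, dotProduct, Finset.sum_mul_sum, Fintype.sum_prod_type]
    exact Finset.sum_congr rfl fun i _ => Finset.sum_congr rfl fun j _ => by ring
  have h2 : ∑ k, v k * (z.2 * feature B z k) = z.2 * (v ⬝ᵥ feature B z) := by
    rw [dotProduct, Finset.mul_sum]
    exact Finset.sum_congr rfl fun i _ => by ring
  rw [h1, h2, pointLoss_transpose_mulVec]
  ring

theorem pointLoss_nonneg (w : Fin d → ℝ) (z : Point 𝒳 𝒴) : 0 ≤ pointLoss w z := sq_nonneg _

theorem pointLoss_le (h𝒳 : 𝒳 ⊆ Metric.closedBall 0 1) (h𝒴 : 𝒴 ⊆ Set.Icc 0 1)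
    {B : Matrix (Fin d) (Fin d) ℝ} {r : ℝ} (hr : (Bᵀ * B).trace ≤ r) {v : Fin d → ℝ}
    (hv : ∑ k, v k ^ 2 ≤ 1) (z : Point 𝒳 𝒴) : pointLoss (Bᵀ *ᵥ v) z ≤ 2 * r + 2 := by
  rw [pointLoss_transpose_mulVec]
  have h1 : (v ⬝ᵥ feature B z) ^ 2 ≤ (∑ k, v k ^ 2) * ∑ k, feature B z k ^ 2 :=
    Finset.sum_mul_sq_le_sq_mul_sq _ _ _
  have h2 : (∑ k, v k ^ 2) * ∑ k, feature B z k ^ 2 ≤ ∑ k, feature B z k ^ 2 :=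
    mul_le_of_le_one_left (by positivity) hv
  have h3 := sum_sq_feature_le h𝒳 hr z
  have h4 := label_mem h𝒴 z
  nlinarith [sq_nonneg (v ⬝ᵥ feature B z + z.2)]

theorem measurable_pointLoss :
    Measurable fun p : (Fin d → ℝ) × Point 𝒳 𝒴 => pointLoss p.1 p.2 := by
  refine Continuous.measurable ?_
  unfold pointLoss sqLoss dotProduct
  fun_prop

variable {D : Matrix (Fin d) (Fin d) ℝ}

theorem measurable_empRisk_ridge (hn : 0 < n) (hD : D.PosSemidef) :
    Measurable fun Z : Fin n → Point 𝒳 𝒴 => empRisk Z (ridge D Z) := by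
  have h : ∀ i, Measurable fun Z : Fin n → Point 𝒳 𝒴 => pointLoss (ridge D Z) (Z i) := fun i => by
    have he : Measurable fun Z : Fin n → Point 𝒳 𝒴 => Z i := by fun_prop
    have hi : Measurable fun Z : Fin n → Point 𝒳 𝒴 => (ridge D Z, Z i) :=
      (measurable_ridge hn hD).prodMk he
    simpa only [Function.comp_def] using (measurable_pointLoss (𝒳 := 𝒳) (𝒴 := 𝒴)).comp hi
  unfold empRisk
  exact Measurable.const_mul (Finset.measurable_fun_sum _ fun i _ => h i) _

theorem measurable_risk_ridge (hn : 0 < n) (hD : D.PosSemidef) :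
    Measurable fun p : ProbabilityMeasure (Point 𝒳 𝒴) × (Fin n → Point 𝒳 𝒴) =>
      risk p.1 (ridge D p.2) := by
  have h : StronglyMeasurable fun q : (ProbabilityMeasure (Point 𝒳 𝒴) × (Fin n → Point 𝒳 𝒴))
      × Point 𝒳 𝒴 => pointLoss (ridge D q.1.2) q.2 :=
    (measurable_pointLoss.comp (((measurable_ridge hn hD).comp
      (measurable_snd.comp measurable_fst)).prodMk measurable_snd)).stronglyMeasurable
  -- Viewing the task as the value of a kernel makes the risk a parametrized integral, jointly
  -- measurable in the task and the dataset.
  exact (h.integral_kernel_prod_right' (κ := (taskKernel 𝒳 𝒴).comap Prod.fst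
    measurable_fst)).measurable

theorem measurable_integral_task {h : Point 𝒳 𝒴 → ℝ} (hh : Measurable h) :
    Measurable fun μ : ProbabilityMeasure (Point 𝒳 𝒴) => ∫ z, h z ∂(μ : Measure (Point 𝒳 𝒴)) :=
  (hh.stronglyMeasurable.integral_kernel (κ := taskKernel 𝒳 𝒴)).measurable

theorem risk_ridge_mem_Icc (h𝒳 : 𝒳 ⊆ Metric.closedBall 0 1) (h𝒴 : 𝒴 ⊆ Set.Icc 0 1) (hn : 0 < n)
    (hD : D.PosSemidef) {r : ℝ} (hr : D.trace ≤ r) (μ : ProbabilityMeasure (Point 𝒳 𝒴))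
    (Z : Fin n → Point 𝒳 𝒴) : risk μ (ridge D Z) ∈ Set.Icc 0 (2 * r + 2) := by
  obtain ⟨B, rfl⟩ := exists_eq_transpose_mul_self hD
  obtain ⟨v, hv, hv1⟩ := exists_ridge_eq Z h𝒴 hn (B := B) rfl
  refine ⟨integral_nonneg fun z => pointLoss_nonneg _ z, ?_⟩
  rw [hv]
  refine (integral_mono_of_nonneg (Filter.Eventually.of_forall fun z => pointLoss_nonneg _ z)
    (integrable_const (2 * r + 2)) (Filter.Eventually.of_forall fun z =>
      pointLoss_le h𝒳 h𝒴 hr hv1 z)).trans_eq (by simp)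

/-- The average squared norm of the features of a task. -/
noncomputable def featureMoment (B : Matrix (Fin d) (Fin d) ℝ)
    (μ : ProbabilityMeasure (Point 𝒳 𝒴)) : ℝ :=
  ∫ z, ∑ k, feature B z k ^ 2 ∂(μ : Measure (Point 𝒳 𝒴))

/-- The centred sum of a function over a dataset. -/
noncomputable def deviation (μ : ProbabilityMeasure (Point 𝒳 𝒴)) (h : Point 𝒳 𝒴 → ℝ)
    (Z : Fin n → Point 𝒳 𝒴) : ℝ :=
  ∑ i, (h (Z i) - ∫ z, h z ∂(μ : Measure (Point 𝒳 𝒴)))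

theorem memLp_of_sq_le (μ : ProbabilityMeasure (Point 𝒳 𝒴)) {h : Point 𝒳 𝒴 → ℝ}
    (hh : Measurable h) {C : ℝ} (hC : ∀ z, h z ^ 2 ≤ C) :
    MemLp h 2 (μ : Measure (Point 𝒳 𝒴)) := by
  refine MemLp.of_bound hh.aestronglyMeasurable (√C) (Filter.Eventually.of_forall fun z => ?_)
  exact Real.abs_le_sqrt (hC z)

/-- The expected norm of the deviations of finitely many functions. -/
theorem integral_sqrt_sum_deviation_le (μ : ProbabilityMeasure (Point 𝒳 𝒴)) {κ : Type*} [Fintype κ]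
    {h : κ → Point 𝒳 𝒴 → ℝ} (hh : ∀ k, Measurable (h k)) {C : ℝ} (hC : ∀ k z, h k z ^ 2 ≤ C)
    {τ : ℝ} (hτ : ∫ z, ∑ k, h k z ^ 2 ∂(μ : Measure (Point 𝒳 𝒴)) ≤ τ) :
    Integrable (fun Z => √(∑ k, deviation μ (h k) Z ^ 2)) (datasetKernel 𝒳 𝒴 n μ) ∧
      ∫ Z, √(∑ k, deviation μ (h k) Z ^ 2) ∂(datasetKernel 𝒳 𝒴 n μ) ≤ √(n * τ) := by
  have hL := fun k => memLp_of_sq_le μ (hh k) (hC k)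
  have hi : ∀ k, Integrable (fun Z => deviation μ (h k) Z ^ 2) (datasetKernel 𝒳 𝒴 n μ) :=
    fun k => integrable_sq_sum_sub (μ : Measure (Point 𝒳 𝒴)) (hL k) _
  have hm : ∀ k, Measurable (deviation (n := n) μ (h k)) := fun k => by
    have := hh k
    unfold deviation
    fun_prop
  have key := integral_le_sqrt_integral (datasetKernel 𝒳 𝒴 n μ)
    (F := fun Z => √(∑ k, deviation μ (h k) Z ^ 2)) (G := fun Z => ∑ k, deviation μ (h k) Z ^ 2)
    (Measurable.aestronglyMeasurable (by fun_prop)) (integrable_finsetSum _ fun k _ => hi k)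
    fun Z => (Real.sq_sqrt (by positivity)).le
  refine ⟨key.1, key.2.trans (Real.sqrt_le_sqrt ?_)⟩
  rw [integral_finsetSum _ fun k _ => hi k]
  refine (Finset.sum_le_sum fun k _ =>
    integral_sq_sum_sub_le (μ : Measure (Point 𝒳 𝒴)) (hL k)).trans ?_
  rw [← Finset.mul_sum, ← integral_finsetSum _ fun k _ => (hL k).integrable_sq]
  gcongr

/-- Expanding `(v ⬝ f - y)²`, the deviation is a quadratic form in `v`, a linear form in `v`, and
the deviation of `y²`, which is free of `v` and is moved to the left. Cauchy–Schwarz with `‖v‖ ≤ 1`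
leaves a right side without `v`, so `v` may later depend on the sample. -/
theorem abs_empRisk_sub_risk_le (h𝒳 : 𝒳 ⊆ Metric.closedBall 0 1) (h𝒴 : 𝒴 ⊆ Set.Icc 0 1)
    (hn : 0 < n) {B : Matrix (Fin d) (Fin d) ℝ} (μ : ProbabilityMeasure (Point 𝒳 𝒴))
    {v : Fin d → ℝ} (hv : ∑ k, v k ^ 2 ≤ 1) (Z : Fin n → Point 𝒳 𝒴) :
    |n * (empRisk Z (Bᵀ *ᵥ v) - risk μ (Bᵀ *ᵥ v)) - deviation μ (fun z => (z.2 : ℝ) ^ 2) Z|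
      ≤ √(∑ p : Fin d × Fin d, deviation μ (fun z => feature B z p.1 * feature B z p.2) Z ^ 2)
        + 2 * √(∑ k, deviation μ (fun z => z.2 * feature B z k) Z ^ 2) := by
  have hn0 : (n : ℝ) ≠ 0 := by positivity
  have hf : ∀ z : Point 𝒳 𝒴, ∑ k, feature B z k ^ 2 ≤ (Bᵀ * B).trace :=
    fun z => sum_sq_feature_le h𝒳 le_rfl z
  have hfk : ∀ (z : Point 𝒳 𝒴) k, |feature B z k| ≤ √(Bᵀ * B).trace := fun z k =>
    Real.abs_le_sqrt ((Finset.single_le_sum (f := fun k => feature B z k ^ 2)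
      (fun _ _ => sq_nonneg _) (Finset.mem_univ k)).trans (hf z))
  have hy : ∀ z : Point 𝒳 𝒴, |(z.2 : ℝ)| ≤ 1 := fun z => abs_le_one_iff_mul_self_le_one.2 (by
    have := label_mem h𝒴 z; rwa [sq] at this)
  have i1 : ∀ p : Fin d × Fin d, Integrable (fun z => feature B z p.1 * feature B z p.2)
      (μ : Measure (Point 𝒳 𝒴)) := fun p => by
    refine .of_bound ((measurable_feature_apply B p.1).mul
      (measurable_feature_apply B p.2)).aestronglyMeasurable
      (√(Bᵀ * B).trace * √(Bᵀ * B).trace) (Filter.Eventually.of_forall fun z => ?_)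
    rw [Real.norm_eq_abs, abs_mul]
    gcongr <;> exact hfk z _
  have hym : Measurable fun z : Point 𝒳 𝒴 => (z.2 : ℝ) := by fun_prop
  have i2 : ∀ k, Integrable (fun z => z.2 * feature B z k) (μ : Measure (Point 𝒳 𝒴)) := fun k => by
    refine .of_bound (hym.mul (measurable_feature_apply B k)).aestronglyMeasurable
      (1 * √(Bᵀ * B).trace) (Filter.Eventually.of_forall fun z => ?_)
    rw [Real.norm_eq_abs, abs_mul]
    gcongr
    · exact hy z
    · exact hfk z k
  have i3 : Integrable (fun z => (z.2 : ℝ) ^ 2) (μ : Measure (Point 𝒳 𝒴)) := by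
    refine .of_bound (hym.pow_const 2).aestronglyMeasurable 1
      (Filter.Eventually.of_forall fun z => ?_)
    rw [Real.norm_eq_abs, abs_of_nonneg (sq_nonneg _)]
    exact label_mem h𝒴 z
  have j1 := integrable_finsetSum Finset.univ fun (p : Fin d × Fin d) _ =>
    (i1 p).const_mul (v p.1 * v p.2)
  have j2 := (integrable_finsetSum Finset.univ fun k _ => (i2 k).const_mul (v k)).const_mul 2
  have j3 : Integrable (fun z => ∑ p : Fin d × Fin d,
      v p.1 * v p.2 * (feature B z p.1 * feature B z p.2)
      - 2 * ∑ k, v k * (z.2 * feature B z k)) (μ : Measure (Point 𝒳 𝒴)) := j1.sub j2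
  have hrisk : risk μ (Bᵀ *ᵥ v)
      = ∑ p : Fin d × Fin d, v p.1 * v p.2 *
          (∫ z, feature B z p.1 * feature B z p.2 ∂(μ : Measure (Point 𝒳 𝒴)))
        - 2 * ∑ k, v k * (∫ z, z.2 * feature B z k ∂(μ : Measure (Point 𝒳 𝒴)))
        + ∫ z, (z.2 : ℝ) ^ 2 ∂(μ : Measure (Point 𝒳 𝒴)) := by
    unfold risk
    simp_rw [pointLoss_expand]
    rw [integral_add j3 i3, integral_sub j1 j2, integral_const_mul,
      integral_finsetSum _ fun p _ => (i1 p).const_mul _,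
      integral_finsetSum _ fun k _ => (i2 k).const_mul _]
    simp_rw [integral_const_mul]
  have hmain : n * (empRisk Z (Bᵀ *ᵥ v) - risk μ (Bᵀ *ᵥ v))
        - deviation μ (fun z => (z.2 : ℝ) ^ 2) Z
      = ∑ p : Fin d × Fin d, v p.1 * v p.2 *
          deviation μ (fun z => feature B z p.1 * feature B z p.2) Z
        - 2 * ∑ k, v k * deviation μ (fun z => z.2 * feature B z k) Z := by
    have e : n * (empRisk Z (Bᵀ *ᵥ v) - risk μ (Bᵀ *ᵥ v))
        = ∑ i, (pointLoss (Bᵀ *ᵥ v) (Z i) - risk μ (Bᵀ *ᵥ v)) := by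
      rw [empRisk, Finset.sum_sub_distrib, Finset.sum_const, Finset.card_univ, Fintype.card_fin,
        nsmul_eq_mul]
      field_simp
    rw [e, hrisk]
    simp only [pointLoss_expand, deviation, Finset.mul_sum]
    rw [← Finset.sum_sub_distrib, Finset.sum_comm (s := (Finset.univ : Finset (Fin d × Fin d))),
      Finset.sum_comm (s := (Finset.univ : Finset (Fin d))), ← Finset.sum_sub_distrib]
    refine Finset.sum_congr rfl fun i _ => ?_
    simp only [mul_sub, Finset.sum_sub_distrib]
    ring
  rw [hmain]
  have hv' : √(∑ p : Fin d × Fin d, (v p.1 * v p.2) ^ 2) ≤ 1 := by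
    rw [sum_sq_mul_eq]
    exact Real.sqrt_le_one.2 (mul_le_one₀ hv (by positivity) hv)
  have b1 := abs_dotProduct_le (fun p : Fin d × Fin d => v p.1 * v p.2)
    fun p => deviation μ (fun z => feature B z p.1 * feature B z p.2) Z
  have b2 := abs_dotProduct_le v fun k => deviation μ (fun z => z.2 * feature B z k) Z
  have b3 := b1.trans (mul_le_of_le_one_left (Real.sqrt_nonneg _) hv')
  have b4 := b2.trans (mul_le_of_le_one_left (Real.sqrt_nonneg _) (Real.sqrt_le_one.2 hv))
  simp only [dotProduct] at b3 b4
  refine (abs_sub _ _).trans (add_le_add b3 ?_)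
  rw [abs_mul, abs_two]
  gcongr

/-- The expected gap between the risk and the training error of ridge regression on one task. -/
theorem abs_integral_risk_sub_empRisk_le (h𝒳 : 𝒳 ⊆ Metric.closedBall 0 1)
    (h𝒴 : 𝒴 ⊆ Set.Icc 0 1) (hn : 0 < n) {B : Matrix (Fin d) (Fin d) ℝ} (hDB : D = Bᵀ * B) {r : ℝ}
    (hr : D.trace ≤ r) (μ : ProbabilityMeasure (Point 𝒳 𝒴)) :
    |∫ Z, (risk μ (ridge D Z) - empRisk Z (ridge D Z)) ∂(datasetKernel 𝒳 𝒴 n μ)|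
      ≤ (√r + 2) / √n * √(featureMoment B μ) := by
  have hD : D.PosSemidef := by
    rw [hDB]; simpa using Matrix.posSemidef_conjTranspose_mul_self B
  have hn0 : (0 : ℝ) < n := by positivity
  have hr0 : 0 ≤ r := hD.trace_nonneg.trans hr
  have hf : ∀ z : Point 𝒳 𝒴, ∑ k, feature B z k ^ 2 ≤ r :=
    fun z => sum_sq_feature_le h𝒳 (hDB ▸ hr) z
  have hfk : ∀ (z : Point 𝒳 𝒴) k, feature B z k ^ 2 ≤ r := fun z k =>
    (Finset.single_le_sum (f := fun k => feature B z k ^ 2)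
      (fun _ _ => sq_nonneg _) (Finset.mem_univ k)).trans (hf z)
  have hτ : Integrable (fun z => ∑ k, feature B z k ^ 2) (μ : Measure (Point 𝒳 𝒴)) := by
    refine .of_bound (Finset.measurable_fun_sum _ fun k _ =>
      (measurable_feature_apply B k).pow_const 2).aestronglyMeasurable r
      (Filter.Eventually.of_forall fun z => ?_)
    rw [Real.norm_eq_abs, abs_of_nonneg (by positivity)]
    exact hf z
  have hym : Measurable fun z : Point 𝒳 𝒴 => (z.2 : ℝ) := by fun_prop
  obtain ⟨q1, q2⟩ := integral_sqrt_sum_deviation_le (n := n) μ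
    (h := fun (p : Fin d × Fin d) z => feature B z p.1 * feature B z p.2)
    (fun p => (measurable_feature_apply B p.1).mul (measurable_feature_apply B p.2))
    (C := r * r) (fun p z => by rw [mul_pow]; gcongr <;> exact hfk z _)
    -- The sum over pairs of the squared feature products is `‖Bx‖⁴`; one factor `‖Bx‖²` is bounded
    -- by `r`, the other is kept so that the covariance can enter.
    (τ := r * featureMoment B μ) (by
      rw [featureMoment, ← integral_const_mul]
      refine integral_mono_of_nonneg (Filter.Eventually.of_forall fun z => by positivity)
        (hτ.const_mul r) (Filter.Eventually.of_forall fun z => ?_)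
      simp only
      rw [sum_sq_mul_eq]
      gcongr
      exact hf z)
  obtain ⟨q3, q4⟩ := integral_sqrt_sum_deviation_le (n := n) μ
    (h := fun k z => z.2 * feature B z k)
    (fun k => hym.mul (measurable_feature_apply B k))
    (C := r) (fun k z => by
      rw [mul_pow]
      exact (mul_le_of_le_one_left (sq_nonneg _) (label_mem h𝒴 z)).trans (hfk z k))
    (τ := featureMoment B μ) (by
      refine integral_mono_of_nonneg (Filter.Eventually.of_forall fun z => by positivity)
        hτ (Filter.Eventually.of_forall fun z => Finset.sum_le_sum fun k _ => ?_)
      rw [mul_pow]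
      exact mul_le_of_le_one_left (sq_nonneg _) (label_mem h𝒴 z))
  have hyL : MemLp (fun z : Point 𝒳 𝒴 => (z.2 : ℝ) ^ 2) 2 (μ : Measure (Point 𝒳 𝒴)) :=
    memLp_of_sq_le μ (hym.pow_const 2) (C := 1) fun z => pow_le_one₀ (sq_nonneg _) (label_mem h𝒴 z)
  have hyi : Integrable (fun z : Point 𝒳 𝒴 => (z.2 : ℝ) ^ 2) (μ : Measure (Point 𝒳 𝒴)) :=
    hyL.integrable (by norm_num)
  have hterm : ∀ i : Fin n, Integrable (fun Z : Fin n → Point 𝒳 𝒴 => ((Z i).2 : ℝ) ^ 2)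
      (datasetKernel 𝒳 𝒴 n μ) := fun i => integrable_eval (μ : Measure (Point 𝒳 𝒴)) hyi i
  have hdev : Integrable (deviation μ fun z => (z.2 : ℝ) ^ 2) (datasetKernel 𝒳 𝒴 n μ) :=
    integrable_finsetSum _ fun i _ => (hterm i).sub (integrable_const _)
  -- The label term is not small for a given sample, but it is centred and disappears from the
  -- expected gap.
  have hdev0 : ∫ Z, deviation μ (fun z => (z.2 : ℝ) ^ 2) Z ∂(datasetKernel 𝒳 𝒴 n μ) = 0 := by
    have hs : ∀ i : Fin n, Integrable (fun Z : Fin n → Point 𝒳 𝒴 => ((Z i).2 : ℝ) ^ 2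
        - ∫ z, (z.2 : ℝ) ^ 2 ∂(μ : Measure (Point 𝒳 𝒴))) (datasetKernel 𝒳 𝒴 n μ) :=
      fun i => (hterm i).sub (integrable_const _)
    simp only [deviation]
    rw [integral_finsetSum _ fun i _ => hs i]
    refine Finset.sum_eq_zero fun i _ => ?_
    rw [integral_sub (hterm i) (integrable_const _)]
    have := integral_eval (μ : Measure (Point 𝒳 𝒴)) hyi i
    simp only [integral_const, probReal_univ, smul_eq_mul, one_mul]
    exact sub_eq_zero.2 this
  have hrm : Measurable fun Z : Fin n → Point 𝒳 𝒴 => risk μ (ridge D Z) :=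
    (measurable_risk_ridge hn hD).comp measurable_prodMk_left
  have hri : Integrable (fun Z => risk μ (ridge D Z)) (datasetKernel 𝒳 𝒴 n μ) := by
    refine .of_bound hrm.aestronglyMeasurable (2 * r + 2) (Filter.Eventually.of_forall fun Z => ?_)
    have := risk_ridge_mem_Icc h𝒳 h𝒴 hn hD hr μ Z
    rw [Real.norm_eq_abs, abs_of_nonneg this.1]
    exact this.2
  have hei : Integrable (fun Z => empRisk Z (ridge D Z)) (datasetKernel 𝒳 𝒴 n μ) := by
    refine .of_bound (measurable_empRisk_ridge hn hD).aestronglyMeasurable 1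
      (Filter.Eventually.of_forall fun Z => ?_)
    have := empRisk_ridge_mem_Icc Z h𝒴 hn hD
    rw [Real.norm_eq_abs, abs_of_nonneg this.1]
    exact this.2
  have hdi : Integrable (fun Z => n * (empRisk Z (ridge D Z) - risk μ (ridge D Z)))
      (datasetKernel 𝒳 𝒴 n μ) := (hei.sub hri).const_mul _
  have hgap : n * |∫ Z, (risk μ (ridge D Z) - empRisk Z (ridge D Z)) ∂(datasetKernel 𝒳 𝒴 n μ)|
      ≤ √(n * (r * featureMoment B μ)) + 2 * √(n * featureMoment B μ) := by
    calc _ = |∫ Z, (n * (empRisk Z (ridge D Z) - risk μ (ridge D Z))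
          - deviation μ (fun z => (z.2 : ℝ) ^ 2) Z) ∂(datasetKernel 𝒳 𝒴 n μ)| := by
          rw [integral_sub hdi hdev, hdev0, sub_zero, integral_const_mul,
            abs_mul, abs_of_pos hn0, ← abs_neg, ← integral_neg]
          simp only [neg_sub]
      _ ≤ ∫ Z, |n * (empRisk Z (ridge D Z) - risk μ (ridge D Z))
          - deviation μ (fun z => (z.2 : ℝ) ^ 2) Z| ∂(datasetKernel 𝒳 𝒴 n μ) :=
          abs_integral_le_integral_abs
      _ ≤ ∫ Z, (√(∑ p : Fin d × Fin d,
            deviation μ (fun z => feature B z p.1 * feature B z p.2) Z ^ 2)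
          + 2 * √(∑ k, deviation μ (fun z => z.2 * feature B z k) Z ^ 2))
            ∂(datasetKernel 𝒳 𝒴 n μ) := by
          refine integral_mono (hdi.sub hdev).abs
            (q1.add (q3.const_mul 2)) fun Z => ?_
          obtain ⟨v, hv, hv1⟩ := exists_ridge_eq Z h𝒴 hn hDB
          simp only [hv]
          exact abs_empRisk_sub_risk_le h𝒳 h𝒴 hn μ hv1 Z
      _ ≤ _ := by
          rw [integral_add q1 (q3.const_mul 2), integral_const_mul]
          gcongr
  rw [Real.sqrt_mul hn0.le, Real.sqrt_mul hr0, Real.sqrt_mul hn0.le] at hgap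
  have hsn : √(n : ℝ) * √n = n := Real.mul_self_sqrt hn0.le
  have hsn0 : 0 < √(n : ℝ) := Real.sqrt_pos.2 hn0
  rw [div_mul_eq_mul_div, le_div_iff₀ hsn0]
  refine le_of_mul_le_mul_left ?_ hsn0
  calc _ = n * |∫ Z, (risk μ (ridge D Z) - empRisk Z (ridge D Z)) ∂(datasetKernel 𝒳 𝒴 n μ)| := by
        rw [mul_comm _ √(n : ℝ), ← mul_assoc, hsn]
    _ ≤ _ := hgap
    _ = _ := by ring

end Task


/-! ### Averaging over tasks: transfer risk against expected training error. -/

section Environment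

variable {d : ℕ} {𝒳 : Set (EuclideanSpace ℝ (Fin d))} {𝒴 : Set ℝ} {n : ℕ}
  (ρ : Measure (ProbabilityMeasure (Point 𝒳 𝒴))) [IsProbabilityMeasure ρ]
  {D : Matrix (Fin d) (Fin d) ℝ}

theorem dotProduct_mulVec_le_opNorm (A : Matrix (Fin d) (Fin d) ℝ) (b : Fin d → ℝ) :
    b ⬝ᵥ (A *ᵥ b) ≤ opNorm A * ∑ k, b k ^ 2 := by
  set x : EuclideanSpace ℝ (Fin d) := WithLp.toLp 2 b with hx
  have h1 : b ⬝ᵥ (A *ᵥ b) = inner ℝ x (Matrix.toEuclideanCLM (n := Fin d) (𝕜 := ℝ) A x) := by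
    rw [EuclideanSpace.inner_eq_star_dotProduct, dotProduct_comm]
    rfl
  have h2 : ∑ k, b k ^ 2 = ‖x‖ * ‖x‖ := by
    rw [← sq, EuclideanSpace.real_norm_sq_eq]
  rw [h1, h2]
  refine (real_inner_le_norm _ _).trans ?_
  have := (Matrix.toEuclideanCLM (n := Fin d) (𝕜 := ℝ) A).le_opNorm x
  calc _ ≤ ‖x‖ * (opNorm A * ‖x‖) := by gcongr; exact this
    _ = _ := by ring

theorem integrable_featureMoment (h𝒳 : 𝒳 ⊆ Metric.closedBall 0 1)
    (B : Matrix (Fin d) (Fin d) ℝ) : Integrable (featureMoment (𝒳 := 𝒳) (𝒴 := 𝒴) B) ρ := by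
  have hm : Measurable fun z : Point 𝒳 𝒴 => ∑ k, feature B z k ^ 2 :=
    Finset.measurable_fun_sum _ fun k _ => (measurable_feature_apply B k).pow_const 2
  refine .of_bound (measurable_integral_task hm).aestronglyMeasurable (Bᵀ * B).trace
    (Filter.Eventually.of_forall fun μ => ?_)
  rw [Real.norm_eq_abs, abs_of_nonneg (a := featureMoment B μ)
    (integral_nonneg fun z => by positivity)]
  refine (integral_mono_of_nonneg (Filter.Eventually.of_forall fun z => by positivity)
    (integrable_const (Bᵀ * B).trace) (Filter.Eventually.of_forall fun z =>
      sum_sq_feature_le h𝒳 le_rfl z)).trans_eq (by simp)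

/-- The left side is `tr(BᵀB C_ρ)`, the sum of `bᵀ C_ρ b` over the rows `b` of `B`; each term is at
most `‖C_ρ‖ ‖b‖²`. -/
theorem integral_featureMoment_le (h𝒳 : 𝒳 ⊆ Metric.closedBall 0 1)
    (B : Matrix (Fin d) (Fin d) ℝ) :
    ∫ μ, featureMoment B μ ∂ρ ≤ opNorm (covMatrix ρ) * (Bᵀ * B).trace := by
  have hx : ∀ (z : Point 𝒳 𝒴) a, |z.1.1 a| ≤ 1 := fun z a => by
    rw [← sq_le_one_iff_abs_le_one]
    exact (Finset.single_le_sum (f := fun a => z.1.1 a ^ 2) (fun _ _ => sq_nonneg _)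
      (Finset.mem_univ a)).trans (sum_sq_input_le h𝒳 z.1)
  have hxm : ∀ p : Fin d × Fin d, Measurable fun z : Point 𝒳 𝒴 => z.1.1 p.1 * z.1.1 p.2 :=
    fun p => Continuous.measurable (by fun_prop)
  have hx2 : ∀ (p : Fin d × Fin d) (z : Point 𝒳 𝒴), ‖z.1.1 p.1 * z.1.1 p.2‖ ≤ 1 := fun p z => by
    rw [Real.norm_eq_abs, abs_mul]
    exact mul_le_one₀ (hx z _) (abs_nonneg _) (hx z _)
  have i1 : ∀ (p : Fin d × Fin d) (μ : ProbabilityMeasure (Point 𝒳 𝒴)),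
      Integrable (fun z => z.1.1 p.1 * z.1.1 p.2) (μ : Measure (Point 𝒳 𝒴)) := fun p μ =>
    .of_bound (hxm p).aestronglyMeasurable 1 (Filter.Eventually.of_forall (hx2 p))
  have i2 : ∀ p : Fin d × Fin d, Integrable (fun μ : ProbabilityMeasure (Point 𝒳 𝒴) =>
      ∫ z, z.1.1 p.1 * z.1.1 p.2 ∂(μ : Measure (Point 𝒳 𝒴))) ρ := fun p => by
    refine .of_bound (measurable_integral_task (hxm p)).aestronglyMeasurable 1
      (Filter.Eventually.of_forall fun μ => ?_)
    refine (norm_integral_le_of_norm_le_const (C := 1)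
      (Filter.Eventually.of_forall (hx2 p))).trans_eq (by simp)
  have e1 : ∀ z : Point 𝒳 𝒴, ∑ k, feature B z k ^ 2
      = ∑ p : Fin d × Fin d, (Bᵀ * B) p.1 p.2 * (z.1.1 p.1 * z.1.1 p.2) := fun z => by
    rw [← dotProduct_mulVec_eq_sum (Bᵀ * B) (WithLp.ofLp z.1.1) (WithLp.ofLp z.1.1),
      ← Matrix.mulVec_mulVec, Matrix.dotProduct_mulVec, Matrix.vecMul_transpose]
    simp only [dotProduct, sq, feature]
  have e2 : ∫ μ, featureMoment B μ ∂ρ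
      = ∑ p : Fin d × Fin d, (Bᵀ * B) p.1 p.2 * covMatrix ρ p.1 p.2 := by
    have : ∀ μ : ProbabilityMeasure (Point 𝒳 𝒴), featureMoment B μ
        = ∑ p : Fin d × Fin d, (Bᵀ * B) p.1 p.2 *
          ∫ z, z.1.1 p.1 * z.1.1 p.2 ∂(μ : Measure (Point 𝒳 𝒴)) := fun μ => by
      simp only [featureMoment, e1]
      rw [integral_finsetSum _ fun p _ => (i1 p μ).const_mul _]
      simp_rw [integral_const_mul]
    simp_rw [this]
    rw [integral_finsetSum _ fun p _ => (i2 p).const_mul _]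
    simp_rw [integral_const_mul]
    rfl
  have e3 : ∑ p : Fin d × Fin d, (Bᵀ * B) p.1 p.2 * covMatrix ρ p.1 p.2
      = ∑ k, B k ⬝ᵥ (covMatrix ρ *ᵥ B k) := by
    simp only [dotProduct_mulVec_eq_sum]
    rw [Finset.sum_comm]
    refine Finset.sum_congr rfl fun p _ => ?_
    rw [Matrix.mul_apply, Finset.sum_mul]
    exact Finset.sum_congr rfl fun k _ => by rw [Matrix.transpose_apply]; ring
  rw [e2, e3, trace_transpose_mul_self_eq, Fintype.sum_prod_type, Finset.mul_sum]
  exact Finset.sum_le_sum fun k _ => dotProduct_mulVec_le_opNorm _ _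

/-- The law of the dataset of a random task. -/
noncomputable def datasetLaw (n : ℕ) : Measure (Fin n → Point 𝒳 𝒴) :=
  (ρ ⊗ₘ datasetKernel 𝒳 𝒴 n).snd

instance : IsProbabilityMeasure (datasetLaw ρ n) := by
  unfold datasetLaw; infer_instance

theorem integrable_empRisk_ridge (h𝒴 : 𝒴 ⊆ Set.Icc 0 1) (hn : 0 < n) (hD : D.PosSemidef)
    (m : Measure (Fin n → Point 𝒳 𝒴)) [IsProbabilityMeasure m] :
    Integrable (fun Z => empRisk Z (ridge D Z)) m := by
  refine .of_bound (measurable_empRisk_ridge hn hD).aestronglyMeasurable 1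
    (Filter.Eventually.of_forall fun Z => ?_)
  have := empRisk_ridge_mem_Icc Z h𝒴 hn hD
  rw [Real.norm_eq_abs, abs_of_nonneg this.1]
  exact this.2

/-- The transfer risk is close to the expected training error. -/
theorem abs_transferRisk_sub_le (h𝒳 : 𝒳 ⊆ Metric.closedBall 0 1) (h𝒴 : 𝒴 ⊆ Set.Icc 0 1)
    (hn : 0 < n) {lam : ℝ} (hlam : 0 < lam) (hD : D ∈ reprSet d lam) :
    |transferRisk ρ n D - ∫ Z, empRisk Z (ridge D Z) ∂(datasetLaw ρ n)|
      ≤ 2 * √(opNorm (covMatrix ρ)) / √n * ((1 + √lam) / lam) := by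
  obtain ⟨hpsd, hr⟩ := hD
  obtain ⟨B, hDB⟩ := exists_eq_transpose_mul_self hpsd
  set r := 1 / lam with hr_def
  have i1 : Integrable (fun p : ProbabilityMeasure (Point 𝒳 𝒴) × (Fin n → Point 𝒳 𝒴) =>
      risk p.1 (ridge D p.2)) (ρ ⊗ₘ datasetKernel 𝒳 𝒴 n) := by
    refine .of_bound (measurable_risk_ridge hn hpsd).aestronglyMeasurable (2 * r + 2)
      (Filter.Eventually.of_forall fun p => ?_)
    have := risk_ridge_mem_Icc h𝒳 h𝒴 hn hpsd hr p.1 p.2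
    rw [Real.norm_eq_abs, abs_of_nonneg this.1]
    exact this.2
  have i2 : Integrable (fun p : ProbabilityMeasure (Point 𝒳 𝒴) × (Fin n → Point 𝒳 𝒴) =>
      empRisk p.2 (ridge D p.2)) (ρ ⊗ₘ datasetKernel 𝒳 𝒴 n) := by
    refine .of_bound ((measurable_empRisk_ridge hn hpsd).comp measurable_snd).aestronglyMeasurable 1
      (Filter.Eventually.of_forall fun p => ?_)
    have := empRisk_ridge_mem_Icc p.2 h𝒴 hn hpsd
    rw [Real.norm_eq_abs, abs_of_nonneg this.1]
    exact this.2
  have e1 : ∫ Z, empRisk Z (ridge D Z) ∂(datasetLaw ρ n)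
      = ∫ p, empRisk p.2 (ridge D p.2) ∂(ρ ⊗ₘ datasetKernel 𝒳 𝒴 n) := by
    rw [datasetLaw, Measure.snd, integral_map measurable_snd.aemeasurable
      (measurable_empRisk_ridge hn hpsd).aestronglyMeasurable]
  have e2 : transferRisk ρ n D = ∫ p, risk p.1 (ridge D p.2) ∂(ρ ⊗ₘ datasetKernel 𝒳 𝒴 n) := by
    rw [Measure.integral_compProd i1, transferRisk]
  -- Jensen takes the average over tasks inside the square root, where the covariance bound applies.
  obtain ⟨f1, f2⟩ := integral_le_sqrt_integral ρ (F := fun μ => √(featureMoment B μ))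
    (integrable_featureMoment ρ h𝒳 B).aestronglyMeasurable.aemeasurable.sqrt.aestronglyMeasurable
    (integrable_featureMoment ρ h𝒳 B)
    (fun μ => (Real.sq_sqrt (integral_nonneg fun z => by positivity)).le)
  have hτ : ∫ μ, featureMoment B μ ∂ρ ≤ opNorm (covMatrix ρ) * (1 / lam) := by
    refine (integral_featureMoment_le ρ h𝒳 B).trans ?_
    rw [← hDB]
    exact mul_le_mul_of_nonneg_left hr (norm_nonneg _)
  have hi12 : Integrable (fun p : ProbabilityMeasure (Point 𝒳 𝒴) × (Fin n → Point 𝒳 𝒴) =>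
      risk p.1 (ridge D p.2) - empRisk p.2 (ridge D p.2)) (ρ ⊗ₘ datasetKernel 𝒳 𝒴 n) := i1.sub i2
  rw [e1, e2, ← integral_sub i1 i2, Measure.integral_compProd hi12]
  have hsn : 0 < √(n : ℝ) := Real.sqrt_pos.2 (by positivity)
  have hsl : 0 < √lam := Real.sqrt_pos.2 hlam
  have hsl2 : √lam * √lam = lam := Real.mul_self_sqrt hlam.le
  have hop : 0 ≤ opNorm (covMatrix ρ) := norm_nonneg _
  calc _ ≤ ∫ μ, |∫ Z, (risk μ (ridge D Z) - empRisk Z (ridge D Z)) ∂(datasetKernel 𝒳 𝒴 n μ)| ∂ρ :=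
        abs_integral_le_integral_abs
    _ ≤ ∫ μ, (√r + 2) / √n * √(featureMoment B μ) ∂ρ :=
        integral_mono_of_nonneg (Filter.Eventually.of_forall fun μ => abs_nonneg _)
          (f1.const_mul _) (Filter.Eventually.of_forall fun μ =>
            abs_integral_risk_sub_empRisk_le h𝒳 h𝒴 hn hDB hr μ)
    _ ≤ (√r + 2) / √n * √(opNorm (covMatrix ρ) * (1 / lam)) := by
        rw [integral_const_mul]
        gcongr
        exact f2.trans (Real.sqrt_le_sqrt hτ)
    -- `(1 / √λ + 2) * (1 / √λ) = (1 + 2√λ) / λ`, then bounded by `2 (1 + √λ) / λ`.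
    _ = √(opNorm (covMatrix ρ)) / √n * ((1 + 2 * √lam) / lam) := by
        rw [hr_def, Real.sqrt_mul hop, Real.sqrt_div zero_le_one, Real.sqrt_one]
        nth_rw 4 [← hsl2]
        field_simp
    _ ≤ √(opNorm (covMatrix ρ)) / √n * ((2 * (1 + √lam)) / lam) := by
        gcongr
        linarith
    _ = _ := by ring

end Environment


/-! ### Concentration of the supremum of centred sums. -/

section UniformDeviation

variable {Ω : Type*} [MeasurableSpace Ω] (m : Measure Ω) [IsProbabilityMeasure m]
  {ι : Type*} [Finite ι] [Nonempty ι]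

theorem integrable_of_mem_Icc {f : Ω → ℝ} (hf : Measurable f) (h : ∀ z, f z ∈ Set.Icc 0 1) :
    Integrable f m := by
  refine .of_bound hf.aestronglyMeasurable 1 (Filter.Eventually.of_forall fun z => ?_)
  rw [Real.norm_eq_abs, abs_of_nonneg (h z).1]
  exact (h z).2

theorem integral_mem_Icc {f : Ω → ℝ} (hf : Measurable f) (h : ∀ z, f z ∈ Set.Icc 0 1) :
    ∫ z, f z ∂m ∈ Set.Icc 0 1 :=
  ⟨integral_nonneg fun z => (h z).1, (integral_mono (integrable_of_mem_Icc m hf h)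
    (integrable_const 1) fun z => (h z).2).trans_eq (by simp)⟩

/-- Concentration of the largest centred sum, measured relative to a fixed function. -/
theorem measure_iSup_sum_centred_ge_le {f : ι → Ω → ℝ} {f' : Ω → ℝ}
    (hfm : ∀ i, Measurable (f i)) (hfm' : Measurable f') (hmem : ∀ i z, f i z ∈ Set.Icc 0 1)
    (hmem' : ∀ z, f' z ∈ Set.Icc 0 1) {T : ℕ} (hT : 0 < T) {b : ℝ}
    (hb : ∫ x : Fin T → Ω, ⨆ i, ∑ t, (∫ z, f i z ∂m - f i (x t)) ∂(Measure.pi fun _ => m) ≤ b)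
    {ε : ℝ} (hε : 0 ≤ ε) :
    (Measure.pi fun _ : Fin T => m).real
      {x | b + ε ≤ ⨆ i, ∑ t, ((∫ z, f i z ∂m - f i (x t)) - (∫ z, f' z ∂m - f' (x t)))}
      ≤ Real.exp (-ε ^ 2 / (2 * T)) := by
  have hT0 : (0 : ℝ) < T := by positivity
  have hf := fun i => integrable_of_mem_Icc m (hfm i) (hmem i)
  have hf' := integrable_of_mem_Icc m hfm' hmem'
  -- Subtracting the reference `f'` inside the supremum covers the deviations of `f i` and of `f'`
  -- by a single use of McDiarmid. The oscillation of each summand becomes 2, whence the exponent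
  -- `-ε ^ 2 / (2 * T)`.
  set e : ι → Ω → ℝ := fun i z => (∫ z, f i z ∂m - f i z) - (∫ z, f' z ∂m - f' z) with he
  have hem : ∀ i, Measurable (e i) := fun i => by
    have := hfm i
    fun_prop
  have hosc : ∀ i z z', e i z - e i z' ≤ 2 := fun i z z' => by
    simp only [he]
    linarith [(hmem i z).1, (hmem i z').2, (hmem' z).2, (hmem' z').1]
  have hbd : ∀ i z, |e i z| ≤ 4 := fun i z => by
    have h5 := integral_mem_Icc m (hfm i) (hmem i)
    have h6 := integral_mem_Icc m hfm' hmem'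
    simp only [he, abs_le]
    constructor <;> linarith [(hmem i z).1, (hmem i z).2, (hmem' z).2, (hmem' z).1, h5.1, h5.2,
      h6.1, h6.2]
  have hsum : ∀ i (x : Fin T → Ω), |∑ t, e i (x t)| ≤ T * 4 :=
    fun i x => (Finset.abs_sum_le_sum_abs _ _).trans
      ((Finset.sum_le_sum fun t _ => hbd i (x t)).trans_eq (by simp))
  set F : (Fin T → Ω) → ℝ := fun x => ⨆ i, ∑ t, e i (x t) with hF
  have hFm : Measurable F := Measurable.iSup fun i => by
    have := hem i
    fun_prop
  have hFM : ∀ x, |F x| ≤ T * 4 := fun x => by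
    obtain ⟨i, hi⟩ := exists_eq_ciSup_of_finite (f := fun i => ∑ t, e i (x t))
    simp only [hF]
    rw [← hi]
    exact hsum i x
  have hFc : ∀ x t a b, F (Function.update x t a) - F (Function.update x t b) ≤ 2 := by
    intro x t a b
    rw [sub_le_iff_le_add]
    refine ciSup_le fun i => ?_
    have h2 : ∀ u, ∑ s, e i (Function.update x t u s)
        = e i u + ∑ s ∈ Finset.univ.erase t, e i (x s) := fun u => by
      rw [← Finset.add_sum_erase _ _ (Finset.mem_univ t), Function.update_self]
      congr 1
      refine Finset.sum_congr rfl fun s hs => ?_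
      rw [Function.update_of_ne (Finset.ne_of_mem_erase hs)]
    have h3 := hosc i a b
    have h4 : ∑ s, e i (Function.update x t b s) ≤ F (Function.update x t b) :=
      le_iSup_of_finite (fun i => ∑ s, e i (Function.update x t b s)) i
    rw [h2] at h4 ⊢
    linarith
  -- The reference sum does not depend on `i`, so it leaves the supremum, and it is centred, so the
  -- mean is unchanged.
  have hmean : ∫ x, F x ∂(Measure.pi fun _ : Fin T => m) ≤ b := by
    refine le_trans (le_of_eq ?_) hb
    have hterm' : Integrable (fun z => ∫ z, f' z ∂m - f' z) m := (integrable_const _).sub hf'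
    have hrest : Integrable (fun x : Fin T → Ω => ∑ t, (∫ z, f' z ∂m - f' (x t)))
        (Measure.pi fun _ => m) := integrable_finsetSum _ fun t _ => integrable_eval m hterm' t
    have hrest0 : ∫ x : Fin T → Ω, ∑ t, (∫ z, f' z ∂m - f' (x t)) ∂(Measure.pi fun _ => m) = 0 := by
      rw [integral_finsetSum _ fun t _ => integrable_eval m hterm' t]
      refine Finset.sum_eq_zero fun t _ => ?_
      rw [integral_eval m hterm' t, integral_sub (integrable_const _) hf']
      simp
    have hmain : Integrable (fun x : Fin T → Ω => ⨆ i, ∑ t, (∫ z, f i z ∂m - f i (x t)))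
        (Measure.pi fun _ => m) :=
      integrable_iSup_of_finite (fun i => by have := hfm i; fun_prop) fun i =>
        integrable_finsetSum _ fun t _ =>
          integrable_eval m ((integrable_const (∫ z, f i z ∂m)).sub (hf i)) t
    have hsplit : ∀ x, F x = (⨆ i, ∑ t, (∫ z, f i z ∂m - f i (x t)))
        - ∑ t, (∫ z, f' z ∂m - f' (x t)) := fun x => by
      rw [ciSup_sub (Set.finite_range _).bddAbove]
      simp only [hF, he, ← Finset.sum_sub_distrib]
    simp_rw [hsplit]
    rw [integral_sub hmain hrest, hrest0, sub_zero]
  have hmc := measure_ge_le_of_boundedDifferences m hFm hFM hT (c := 2) two_pos hε hFc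
  refine (measureReal_mono fun x hx => ?_).trans (hmc.trans_eq ?_)
  · exact (add_le_add_left hmean ε).trans hx
  · congr 1
    field_simp

end UniformDeviation

/-! ### Uniform deviation of training errors over the matrix class. -/

section Multitask

variable {d : ℕ} {𝒳 : Set (EuclideanSpace ℝ (Fin d))} {𝒴 : Set ℝ} {n : ℕ}
  (ν : Measure (Fin n → Point 𝒳 𝒴)) [IsProbabilityMeasure ν]

theorem sqrt_sum_sq_le_of_mem_reprSet {lam : ℝ} {D : Matrix (Fin d) (Fin d) ℝ}
    (hD : D ∈ reprSet d lam) : √(∑ p : Fin d × Fin d, D p.1 p.2 ^ 2) ≤ 1 / lam :=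
  (sqrt_sum_sq_le_trace hD.1).trans hD.2

/-- The second moment of the Gaussian process that dominates the training errors. -/
theorem integral_sum_sq_gaussian_le (h𝒳 : 𝒳 ⊆ Metric.closedBall 0 1) (hn : 0 < n) (T : ℕ) :
    Integrable (fun y : Fin T → (Fin n → Point 𝒳 𝒴) × EuclideanSpace ℝ (Fin n × Fin n) =>
      ∑ p, (∑ t, inner ℝ (gramCoeff (y t).1 p) (y t).2) ^ 2)
      (Measure.pi fun _ => ν.prod (stdGaussian _)) ∧
    ∫ y : Fin T → (Fin n → Point 𝒳 𝒴) × EuclideanSpace ℝ (Fin n × Fin n),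
      ∑ p, (∑ t, inner ℝ (gramCoeff (y t).1 p) (y t).2) ^ 2
      ∂(Measure.pi fun _ => ν.prod (stdGaussian _)) ≤ T := by
  set γ := stdGaussian (EuclideanSpace ℝ (Fin n × Fin n)) with hγ
  have hle : ∀ Z p, ‖gramCoeff (𝒳 := 𝒳) (𝒴 := 𝒴) (n := n) Z p‖ ^ 2 ≤ 1 := fun Z p =>
    (Finset.single_le_sum (f := fun p => ‖gramCoeff Z p‖ ^ 2) (fun _ _ => sq_nonneg _)
      (Finset.mem_univ p)).trans (sum_sq_norm_gramCoeff_le Z h𝒳 hn)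
  have hm : ∀ p : Fin d × Fin d, Measurable
      fun y : (Fin n → Point 𝒳 𝒴) × EuclideanSpace ℝ (Fin n × Fin n) =>
        inner ℝ (gramCoeff y.1 p) y.2 := fun p => by
    have := measurable_gramCoeff (𝒳 := 𝒳) (𝒴 := 𝒴) (n := n) p
    fun_prop
  have hL : ∀ p : Fin d × Fin d, MemLp
      (fun y : (Fin n → Point 𝒳 𝒴) × EuclideanSpace ℝ (Fin n × Fin n) =>
        inner ℝ (gramCoeff y.1 p) y.2) 2 (ν.prod γ) := fun p => by
    have hg : MemLp (fun y : (Fin n → Point 𝒳 𝒴) × EuclideanSpace ℝ (Fin n × Fin n) => y.2) 2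
        (ν.prod γ) :=
      (IsGaussian.memLp_id γ 2 (by norm_num)).comp_measurePreserving measurePreserving_snd
    refine hg.mono (hm p).aestronglyMeasurable (Filter.Eventually.of_forall fun y => ?_)
    exact (norm_inner_le_norm _ _).trans (mul_le_of_le_one_left (norm_nonneg _)
      ((sq_le_one_iff₀ (norm_nonneg _)).1 (hle y.1 p)))
  have hmean : ∀ p : Fin d × Fin d, ∫ y, inner ℝ (gramCoeff y.1 p) y.2 ∂(ν.prod γ) = 0 :=
    fun p => by
    rw [integral_prod _ ((hL p).integrable (by norm_num))]
    simp [integral_inner_stdGaussian, hγ]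
  -- Integrate the Gaussian variable first, with the dataset fixed.
  have hsq : ∀ p : Fin d × Fin d, ∫ y, inner ℝ (gramCoeff y.1 p) y.2 ^ 2 ∂(ν.prod γ)
      = ∫ Z, ‖gramCoeff Z p‖ ^ 2 ∂ν := fun p => by
    rw [integral_prod _ (hL p).integrable_sq]
    simp only [integral_sq_inner_stdGaussian, hγ]
  have hint : ∀ p : Fin d × Fin d, Integrable
      (fun y : Fin T → (Fin n → Point 𝒳 𝒴) × EuclideanSpace ℝ (Fin n × Fin n) =>
        (∑ t, inner ℝ (gramCoeff (y t).1 p) (y t).2) ^ 2) (Measure.pi fun _ => ν.prod γ) :=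
    fun p => by simpa using integrable_sq_sum_sub (T := T) (ν.prod γ) (hL p) 0
  refine ⟨integrable_finsetSum _ fun p _ => hint p, ?_⟩
  rw [integral_finsetSum _ fun p _ => hint p]
  have hbound : ∀ p : Fin d × Fin d,
      ∫ y : Fin T → (Fin n → Point 𝒳 𝒴) × EuclideanSpace ℝ (Fin n × Fin n),
        (∑ t, inner ℝ (gramCoeff (y t).1 p) (y t).2) ^ 2 ∂(Measure.pi fun _ => ν.prod γ)
        ≤ T * ∫ Z, ‖gramCoeff Z p‖ ^ 2 ∂ν := fun p => by
    have := integral_sq_sum_sub_le (T := T) (ν.prod γ) (hL p)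
    rw [hmean p, hsq p] at this
    simpa using this
  refine (Finset.sum_le_sum fun p _ => hbound p).trans ?_
  have hni : ∀ p : Fin d × Fin d, Integrable (fun Z => ‖gramCoeff Z p‖ ^ 2) ν := fun p => by
    have := measurable_gramCoeff (𝒳 := 𝒳) (𝒴 := 𝒴) (n := n) p
    refine .of_bound (Measurable.aestronglyMeasurable (by fun_prop)) 1
      (Filter.Eventually.of_forall fun Z => ?_)
    rw [Real.norm_eq_abs, abs_of_nonneg (sq_nonneg _)]
    exact hle Z p
  rw [← Finset.mul_sum, ← integral_finsetSum _ fun p _ => hni p]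
  refine mul_le_of_le_one_right (by positivity) ?_
  exact (integral_mono (integrable_finsetSum _ fun p _ => hni p) (integrable_const 1) fun Z =>
    sum_sq_norm_gramCoeff_le Z h𝒳 hn).trans_eq (by simp)

theorem two_mul_sqrt_pi_div_two : 2 * √(Real.pi / 2) = √(2 * Real.pi) := by
  rw [show 2 * Real.pi = 2 ^ 2 * (Real.pi / 2) by ring, Real.sqrt_mul (by norm_num),
    Real.sqrt_sq (by norm_num)]

/-- As `gram` is linear in `D`, the Gaussian process is the Frobenius product of `D` with a random
matrix; Cauchy–Schwarz yields a bound uniform over the class and insensitive to the number of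
matrices. -/
theorem sum_inner_gram_le {D : Matrix (Fin d) (Fin d) ℝ} {lam : ℝ} (hD : D ∈ reprSet d lam)
    {c : ℝ} (hc : 0 ≤ c) {T : ℕ}
    (y : Fin T → (Fin n → Point 𝒳 𝒴) × EuclideanSpace ℝ (Fin n × Fin n)) :
    ∑ t, c * inner ℝ (gram D (y t).1) (y t).2
      ≤ c * (1 / lam) * √(∑ p, (∑ t, inner ℝ (gramCoeff (y t).1 p) (y t).2) ^ 2) := by
  have e : ∑ t, inner ℝ (gram D (y t).1) (y t).2
      = ∑ p : Fin d × Fin d, D p.1 p.2 * ∑ t, inner ℝ (gramCoeff (y t).1 p) (y t).2 := by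
    simp only [gram, sum_inner, real_inner_smul_left, Finset.mul_sum]
    exact Finset.sum_comm
  rw [← Finset.mul_sum, e, mul_assoc c (1 / lam)]
  refine mul_le_mul_of_nonneg_left ?_ hc
  exact (Real.sum_mul_le_sqrt_mul_sqrt _ _ _).trans
    (mul_le_mul_of_nonneg_right (sqrt_sum_sq_le_of_mem_reprSet hD) (Real.sqrt_nonneg _))

variable {ι : Type*} [Finite ι] [Nonempty ι] {D : ι → Matrix (Fin d) (Fin d) ℝ} {lam : ℝ}

/-- The expected uniform deviation of the training errors. -/
theorem integral_iSup_sum_empRisk_le (h𝒳 : 𝒳 ⊆ Metric.closedBall 0 1) (h𝒴 : 𝒴 ⊆ Set.Icc 0 1)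
    (hn : 0 < n) (hlam : 0 < lam) (hD : ∀ i, D i ∈ reprSet d lam) (T : ℕ) :
    ∫ x : Fin T → Fin n → Point 𝒳 𝒴, ⨆ i, ∑ t, (∫ Z, empRisk Z (ridge (D i) Z) ∂ν
        - empRisk (x t) (ridge (D i) (x t))) ∂(Measure.pi fun _ => ν)
      ≤ 2 * √(2 * Real.pi) / lam * √T := by
  -- Symmetrization 2, Gaussian comparison `√(π/2)`, Lipschitz constant 2.
  set c := 2 * √(Real.pi / 2) * 2 with hc
  have hc0 : 0 ≤ c := by positivity
  have hfm := fun i => measurable_empRisk_ridge (𝒳 := 𝒳) (𝒴 := 𝒴) hn (hD i).1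
  have hf := fun i => integrable_empRisk_ridge h𝒴 hn (hD i).1 ν
  have hgm := fun i => measurable_gram (𝒳 := 𝒳) (𝒴 := 𝒴) (n := n) (D i)
  have hq : ∀ i, Integrable (fun y : (Fin n → Point 𝒳 𝒴) × EuclideanSpace ℝ (Fin n × Fin n) =>
      c * inner ℝ (gram (D i) y.1) y.2) (ν.prod (stdGaussian _)) := fun i => by
    have hg : Integrable (fun y : (Fin n → Point 𝒳 𝒴) × EuclideanSpace ℝ (Fin n × Fin n) =>
        (∑ p : Fin d × Fin d, |D i p.1 p.2|) * ‖y.2‖) (ν.prod (stdGaussian _)) :=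
      ((IsGaussian.integrable_id (μ := stdGaussian _)).norm.comp_snd ν).const_mul _
    refine Integrable.const_mul (hg.mono' (Measurable.aestronglyMeasurable (by fun_prop))
      (Filter.Eventually.of_forall fun y => ?_)) _
    exact (norm_inner_le_norm _ _).trans (by gcongr; exact norm_gram_le y.1 h𝒳 hn _)
  have htens := integral_iSup_sum_le ν
    (ν.prod (stdGaussian (EuclideanSpace ℝ (Fin n × Fin n))))
    (h := fun i z => ∫ Z, empRisk Z (ridge (D i) Z) ∂ν - empRisk z (ridge (D i) z))
    (q := fun i y => c * inner ℝ (gram (D i) y.1) y.2)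
    (fun i => measurable_const.sub (hfm i)) (fun i => (integrable_const _).sub (hf i))
    (fun i => by fun_prop) hq
    (fun A => integral_iSup_sub_le ν (f := fun i Z => empRisk Z (ridge (D i) Z))
      (φ := fun i => gram (D i)) (M := fun i => ∑ p : Fin d × Fin d, |D i p.1 p.2|) hfm hf hgm
      (fun i z => norm_gram_le z h𝒳 hn _)
      (fun i j z => abs_empRisk_ridge_sub_le z h𝒴 hn (hD i).1 (hD j).1) A) T 0
  simp only [Pi.zero_apply, zero_add] at htens
  refine htens.trans ?_
  obtain ⟨w1, w2⟩ := integral_sum_sq_gaussian_le ν h𝒳 hn T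
  obtain ⟨w3, w4⟩ := integral_le_sqrt_integral
    (Measure.pi fun _ : Fin T => ν.prod (stdGaussian (EuclideanSpace ℝ (Fin n × Fin n))))
    (F := fun y => √(∑ p, (∑ t, inner ℝ (gramCoeff (y t).1 p) (y t).2) ^ 2))
    (Real.continuous_sqrt.comp_aestronglyMeasurable w1.aestronglyMeasurable) w1
    (fun y => (Real.sq_sqrt (by positivity)).le)
  have hsup := fun y : Fin T → (Fin n → Point 𝒳 𝒴) × EuclideanSpace ℝ (Fin n × Fin n) =>
    ciSup_le fun i => sum_inner_gram_le (hD i) hc0 y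
  have hsupi : Integrable (fun y : Fin T → (Fin n → Point 𝒳 𝒴) ×
      EuclideanSpace ℝ (Fin n × Fin n) => ⨆ i, ∑ t, c * inner ℝ (gram (D i) (y t).1) (y t).2)
      (Measure.pi fun _ => ν.prod (stdGaussian _)) := by
    refine integrable_iSup_of_finite (fun i => by fun_prop) fun i => ?_
    exact integrable_finsetSum _ fun t _ => integrable_eval _ (hq i) t
  refine (integral_mono hsupi (w3.const_mul _) hsup).trans ?_
  rw [integral_const_mul]
  have hcc : c * (1 / lam) = 2 * √(2 * Real.pi) / lam := by
    rw [hc, two_mul_sqrt_pi_div_two]; ring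
  rw [hcc]
  gcongr
  exact w4.trans (Real.sqrt_le_sqrt w2)

/-- The centred excess of the training error of `D` over that of `D'`, with the opposite sign. -/
noncomputable def excess (D D' : Matrix (Fin d) (Fin d) ℝ) (Z : Fin n → Point 𝒳 𝒴) : ℝ :=
  (∫ Z', empRisk Z' (ridge D Z') ∂ν - empRisk Z (ridge D Z))
    - (∫ Z', empRisk Z' (ridge D' Z') ∂ν - empRisk Z (ridge D' Z))

/-- The uniform deviation bound for finitely many matrices. -/
theorem measure_iSup_excess_ge_le (h𝒳 : 𝒳 ⊆ Metric.closedBall 0 1) (h𝒴 : 𝒴 ⊆ Set.Icc 0 1)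
    (hn : 0 < n) {T : ℕ} (hT : 0 < T) (hlam : 0 < lam) (hD : ∀ i, D i ∈ reprSet d lam)
    {D' : Matrix (Fin d) (Fin d) ℝ} (hD' : D' ∈ reprSet d lam) {ε : ℝ} (hε : 0 ≤ ε) :
    (Measure.pi fun _ : Fin T => ν).real
      {x | 2 * √(2 * Real.pi) / lam * √T + ε ≤ ⨆ i, ∑ t, excess ν (D i) D' (x t)}
      ≤ Real.exp (-ε ^ 2 / (2 * T)) :=
  measure_iSup_sum_centred_ge_le ν (f := fun i Z => empRisk Z (ridge (D i) Z))
    (f' := fun Z => empRisk Z (ridge D' Z)) (fun i => measurable_empRisk_ridge hn (hD i).1)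
    (measurable_empRisk_ridge hn hD'.1) (fun i Z => empRisk_ridge_mem_Icc Z h𝒴 hn (hD i).1)
    (fun Z => empRisk_ridge_mem_Icc Z h𝒴 hn hD'.1) hT
    (integral_iSup_sum_empRisk_le ν h𝒳 h𝒴 hn hlam hD T) hε

theorem abs_empRisk_ridge_sub_le_sum (h𝒳 : 𝒳 ⊆ Metric.closedBall 0 1) (h𝒴 : 𝒴 ⊆ Set.Icc 0 1)
    (hn : 0 < n) {D D' : Matrix (Fin d) (Fin d) ℝ} (hD : D ∈ reprSet d lam)
    (hD' : D' ∈ reprSet d lam) (Z : Fin n → Point 𝒳 𝒴) :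
    |empRisk Z (ridge D Z) - empRisk Z (ridge D' Z)|
      ≤ 2 * ∑ p : Fin d × Fin d, |(D - D') p.1 p.2| := by
  refine (abs_empRisk_ridge_sub_le Z h𝒴 hn hD.1 hD'.1).trans ?_
  rw [gram_sub]
  gcongr
  exact norm_gram_le Z h𝒳 hn _

theorem abs_excess_sub_le (h𝒳 : 𝒳 ⊆ Metric.closedBall 0 1) (h𝒴 : 𝒴 ⊆ Set.Icc 0 1)
    (hn : 0 < n) {D₁ D₂ : Matrix (Fin d) (Fin d) ℝ} (hD₁ : D₁ ∈ reprSet d lam)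
    (hD₂ : D₂ ∈ reprSet d lam) (D' : Matrix (Fin d) (Fin d) ℝ) (Z : Fin n → Point 𝒳 𝒴) :
    |excess ν D₁ D' Z - excess ν D₂ D' Z| ≤ 4 * ∑ p : Fin d × Fin d, |(D₁ - D₂) p.1 p.2| := by
  set s := ∑ p : Fin d × Fin d, |(D₁ - D₂) p.1 p.2|
  have h1 := abs_empRisk_ridge_sub_le_sum h𝒳 h𝒴 hn hD₁ hD₂ Z
  have h2 : |∫ Z', empRisk Z' (ridge D₁ Z') ∂ν - ∫ Z', empRisk Z' (ridge D₂ Z') ∂ν| ≤ 2 * s := by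
    rw [← integral_sub (integrable_empRisk_ridge h𝒴 hn hD₁.1 ν)
      (integrable_empRisk_ridge h𝒴 hn hD₂.1 ν)]
    have := norm_integral_le_of_norm_le_const (μ := ν)
      (f := fun Z => empRisk Z (ridge D₁ Z) - empRisk Z (ridge D₂ Z)) (C := 2 * s)
      (Filter.Eventually.of_forall fun Z => abs_empRisk_ridge_sub_le_sum h𝒳 h𝒴 hn hD₁ hD₂ Z)
    simpa using this
  rw [abs_le] at *
  simp only [excess]
  constructor <;> linarith [h1.1, h1.2, h2.1, h2.2]

/-- Density is stated in the entrywise `ℓ¹` distance because `abs_excess_sub_le` controls the excess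
in that distance. -/
theorem exists_dense_seq_reprSet (hne : (reprSet d lam).Nonempty) :
    ∃ E : ℕ → Matrix (Fin d) (Fin d) ℝ, (∀ k, E k ∈ reprSet d lam) ∧
      ∀ D ∈ reprSet d lam, ∀ η > 0, ∃ k, ∑ p : Fin d × Fin d, |(D - E k) p.1 p.2| < η := by
  have : SecondCountableTopology (Matrix (Fin d) (Fin d) ℝ) :=
    inferInstanceAs (SecondCountableTopology (Fin d → Fin d → ℝ))
  have : Nonempty (reprSet d lam) := hne.to_subtype
  obtain ⟨u, hu⟩ := TopologicalSpace.exists_dense_seq (reprSet d lam)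
  refine ⟨fun k => u k, fun k => (u k).2, fun D hD η hη => ?_⟩
  have hcont : Continuous fun M : reprSet d lam => ∑ p : Fin d × Fin d, |(D - M.1) p.1 p.2| := by
    refine continuous_finsetSum _ fun p _ => Continuous.abs ?_
    exact ((continuous_const.sub continuous_subtype_val).matrix_elem p.1 p.2)
  have hopen := isOpen_lt hcont (continuous_const (y := η))
  obtain ⟨k, hM⟩ := hu.exists_mem_open hopen ⟨⟨D, hD⟩, by simpa using hη⟩
  exact ⟨k, hM⟩

/-- The uniform deviation bound over the whole class. -/
theorem exists_measurableSet_excess_le (h𝒳 : 𝒳 ⊆ Metric.closedBall 0 1) (h𝒴 : 𝒴 ⊆ Set.Icc 0 1)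
    (hn : 0 < n) {T : ℕ} (hT : 0 < T) (hlam : 0 < lam) {D' : Matrix (Fin d) (Fin d) ℝ}
    (hD' : D' ∈ reprSet d lam) {ε : ℝ} (hε : 0 ≤ ε) :
    ∃ S : Set (Fin T → Fin n → Point 𝒳 𝒴), MeasurableSet S ∧
      1 - Real.exp (-ε ^ 2 / (2 * T)) ≤ (Measure.pi fun _ : Fin T => ν).real S ∧
      ∀ x ∈ S, ∀ D ∈ reprSet d lam,
        ∑ t, excess ν D D' (x t) ≤ 2 * √(2 * Real.pi) / lam * √T + ε := by
  set b := 2 * √(2 * Real.pi) / lam * √T + ε with hb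
  set m := Measure.pi fun _ : Fin T => ν with hm
  obtain ⟨E, hE, hdense⟩ := exists_dense_seq_reprSet ⟨D', hD'⟩
  have hem : ∀ k, Measurable fun x : Fin T → Fin n → Point 𝒳 𝒴 =>
      ∑ t, excess ν (E k) D' (x t) := fun k => by
    have h1 := measurable_empRisk_ridge (𝒳 := 𝒳) (𝒴 := 𝒴) hn (hE k).1
    have h2 := measurable_empRisk_ridge (𝒳 := 𝒳) (𝒴 := 𝒴) hn hD'.1
    have : Measurable (excess ν (E k) D') :=
      (measurable_const.sub h1).sub (measurable_const.sub h2)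
    fun_prop
  -- Bad events for finite prefixes of the dense sequence increase with `N` and share one
  -- probability bound, which passes to their union with no union-bound loss.
  let bad : ℕ → Set (Fin T → Fin n → Point 𝒳 𝒴) := fun N =>
    {x | b ≤ ⨆ k : Fin (N + 1), ∑ t, excess ν (E k) D' (x t)}
  have hmono : Monotone bad := by
    intro N N' h x hx
    refine le_trans (show b ≤ _ from hx) (ciSup_le fun k => ?_)
    exact le_iSup_of_finite (fun k : Fin (N' + 1) => ∑ t, excess ν (E k) D' (x t))
      ⟨k, by omega⟩
  have hbad : ∀ N, m (bad N) ≤ ENNReal.ofReal (Real.exp (-ε ^ 2 / (2 * T))) := fun N => by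
    rw [← ofReal_measureReal]
    exact ENNReal.ofReal_le_ofReal
      (measure_iSup_excess_ge_le ν h𝒳 h𝒴 hn hT hlam (D := fun k : Fin (N + 1) => E k)
        (fun k => hE k) hD' hε)
  have hU : m (⋃ N, bad N) ≤ ENNReal.ofReal (Real.exp (-ε ^ 2 / (2 * T))) := by
    rw [hmono.measure_iUnion]
    exact iSup_le hbad
  have hbm : ∀ N, MeasurableSet (bad N) := fun N =>
    measurableSet_le measurable_const (Measurable.iSup fun k => hem k)
  refine ⟨(⋃ N, bad N)ᶜ, (MeasurableSet.iUnion hbm).compl, ?_, fun x hx D hD => ?_⟩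
  · rw [probReal_compl_eq_one_sub (MeasurableSet.iUnion hbm)]
    have := ENNReal.toReal_le_of_le_ofReal (Real.exp_pos _).le hU
    rw [measureReal_def]
    linarith
  · have hx' : ∀ k, ∑ t, excess ν (E k) D' (x t) < b := fun k => by
      by_contra! hcon
      refine hx (Set.mem_iUnion.2 ⟨k, hcon.trans ?_⟩)
      exact le_iSup_of_finite (fun j : Fin (k + 1) => ∑ t, excess ν (E j) D' (x t)) (Fin.last k)
    refine le_of_forall_pos_le_add fun η hη => ?_
    have hT0 : (0 : ℝ) < T := by positivity
    -- Each of the `T` summands is 4-Lipschitz in `D` (2 for the training error, 2 for its mean), so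
    -- this distance moves the sum by at most `η`.
    obtain ⟨k, hk⟩ := hdense D hD (η / (4 * T)) (by positivity)
    have h1 : ∑ t, excess ν D D' (x t) - ∑ t, excess ν (E k) D' (x t) ≤ η := by
      rw [← Finset.sum_sub_distrib]
      have h2 : ∀ t, excess ν D D' (x t) - excess ν (E k) D' (x t) ≤ 4 * (η / (4 * T)) :=
        fun t => (le_abs_self _).trans ((abs_excess_sub_le ν h𝒳 h𝒴 hn hD (hE k) D' (x t)).trans
          (by gcongr))
      refine (Finset.sum_le_sum fun t _ => h2 t).trans_eq ?_
      simp only [Finset.sum_const, Finset.card_univ, Fintype.card_fin, nsmul_eq_mul]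
      field_simp
    linarith [hx' k]

end Multitask


/-! ### From the sample law to the final bound. -/

/-- The law of the joint sample of independent datasets. -/
theorem map_datasets_eq_pi {d n T : ℕ} {𝒳 : Set (EuclideanSpace ℝ (Fin d))} {𝒴 : Set ℝ}
    (ρ : Measure (ProbabilityMeasure (Point 𝒳 𝒴))) [IsProbabilityMeasure ρ]
    {Ω : Type*} [MeasurableSpace Ω] (P : Measure Ω) [IsProbabilityMeasure P]
    (μ : Fin T → Ω → ProbabilityMeasure (Point 𝒳 𝒴)) (Z : Fin T → Ω → Fin n → Point 𝒳 𝒴)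
    (hlaw : ∀ t, HasLaw (fun ω => (μ t ω, Z t ω)) (ρ ⊗ₘ datasetKernel 𝒳 𝒴 n) P)
    (hindep : iIndepFun (fun t ω => (μ t ω, Z t ω)) P) :
    AEMeasurable (fun ω t => Z t ω) P ∧
      P.map (fun ω t => Z t ω) = Measure.pi fun _ : Fin T => datasetLaw ρ n := by
  have hm : ∀ t, AEMeasurable (Z t) P := fun t =>
    measurable_snd.comp_aemeasurable (hlaw t).aemeasurable
  refine ⟨aemeasurable_pi_lambda _ hm, ?_⟩
  have hind : iIndepFun Z P := hindep.comp (fun _ p => p.2) fun _ => measurable_snd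
  rw [(iIndepFun_iff_map_fun_eq_pi_map hm).1 hind]
  congr 1
  funext t
  rw [datasetLaw, ← (hlaw t).map_eq, Measure.snd,
    AEMeasurable.map_map_of_aemeasurable measurable_snd.aemeasurable (hlaw t).aemeasurable]
  rfl

end LTL

theorem mainTheorem6 {d n T : ℕ} (hn : 0 < n) (hT : 0 < T) {lam : ℝ} (hlam : 0 < lam)
    {𝒳 : Set (EuclideanSpace ℝ (Fin d))} (h𝒳 : 𝒳 ⊆ Metric.closedBall 0 1)
    {𝒴 : Set ℝ} (h𝒴 : 𝒴 ⊆ Set.Icc 0 1)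
    (ρ : Measure (ProbabilityMeasure (LTL.Point 𝒳 𝒴))) [IsProbabilityMeasure ρ]
    {Ω : Type*} [MeasurableSpace Ω] (P : Measure Ω) [IsProbabilityMeasure P]
    (μ : Fin T → Ω → ProbabilityMeasure (LTL.Point 𝒳 𝒴))
    (Z : Fin T → Ω → Fin n → LTL.Point 𝒳 𝒴)
    (hlaw : ∀ t, HasLaw (fun ω => (μ t ω, Z t ω)) (ρ ⊗ₘ LTL.datasetKernel 𝒳 𝒴 n) P)
    (hindep : iIndepFun (fun t ω => (μ t ω, Z t ω)) P)
    (Dhat : Ω → Matrix (Fin d) (Fin d) ℝ)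
    (hDhat : ∀ ω, Dhat ω ∈ LTL.reprSet d lam ∧
      IsMinOn (LTL.multitaskEmpRisk (fun t => Z t ω)) (LTL.reprSet d lam) (Dhat ω))
    (Dstar : Matrix (Fin d) (Fin d) ℝ)
    (hDstar : Dstar ∈ LTL.reprSet d lam ∧
      IsMinOn (LTL.transferRisk ρ n) (LTL.reprSet d lam) Dstar)
    {δ : ℝ} (hδ : δ ∈ Set.Ioc (0 : ℝ) 1) :
    ∃ S : Set Ω, MeasurableSet S ∧ ENNReal.ofReal (1 - δ) ≤ P S ∧ ∀ ω ∈ S,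
      LTL.transferRisk ρ n (Dhat ω) - LTL.transferRisk ρ n Dstar ≤
        4 * √(2 * Real.pi) * √(LTL.opNorm (LTL.covMatrix ρ)) / √n * ((1 + √lam) / lam)
          + 2 * √(2 * Real.pi) / (lam * √T)
          + √(2 * Real.log (2 / δ) / T) := by
  obtain ⟨hδ0, hδ1⟩ := hδ
  have hT0 : (0 : ℝ) < T := by positivity
  have hsT : 0 < √(T : ℝ) := Real.sqrt_pos.2 hT0
  have hsT2 : √(T : ℝ) * √T = T := Real.mul_self_sqrt hT0.le
  have hlog : 0 ≤ Real.log (2 / δ) := Real.log_nonneg (by rw [le_div_iff₀ hδ0]; linarith)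
  obtain ⟨hZm, hZlaw⟩ := LTL.map_datasets_eq_pi ρ P μ Z hlaw hindep
  -- The event serves all matrices simultaneously, so `Dhat` may be inserted pointwise without any
  -- measurability in `ω`. The choice of `ε` makes its failure probability at most `δ / 2`.
  obtain ⟨S, hS, hSP, hSb⟩ := LTL.exists_measurableSet_excess_le (LTL.datasetLaw ρ n) h𝒳 h𝒴 hn hT
    hlam hDstar.1 (ε := √(2 * Real.log (2 / δ) * T)) (Real.sqrt_nonneg _)
  have hexp : Real.exp (-√(2 * Real.log (2 / δ) * T) ^ 2 / (2 * T)) = δ / 2 := by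
    rw [Real.sq_sqrt (by positivity),
      show -(2 * Real.log (2 / δ) * T) / (2 * T) = -Real.log (2 / δ) by field_simp,
      Real.exp_neg, Real.exp_log (by positivity), inv_div]
  rw [hexp] at hSP
  -- The datasets are only almost everywhere measurable, so the preimage of `S` is null-measurable
  -- and is replaced by a measurable subset of equal measure.
  obtain ⟨S', hS'sub, hS'm, hS'ae⟩ :=
    (hZm.nullMeasurable hS).exists_measurable_subset_ae_eq
  refine ⟨S', hS'm, ?_, fun ω hω => ?_⟩
  · rw [measure_congr hS'ae, ← Measure.map_apply_of_aemeasurable hZm hS, hZlaw]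
    refine ENNReal.ofReal_le_of_le_toReal ?_
    rw [measureReal_def] at hSP
    linarith
  · have hdev := hSb _ (hS'sub hω) (Dhat ω) (hDhat ω).1
    have hmin := (hDhat ω).2 hDstar.1
    have hgap₁ := abs_le.1 (LTL.abs_transferRisk_sub_le ρ h𝒳 h𝒴 hn hlam (hDhat ω).1)
    have hgap₂ := abs_le.1 (LTL.abs_transferRisk_sub_le ρ h𝒳 h𝒴 hn hlam hDstar.1)
    simp only [Set.mem_ofPred_eq, LTL.multitaskEmpRisk] at hmin
    have hsum : ∑ t, LTL.excess (LTL.datasetLaw ρ n) (Dhat ω) Dstar (Z t ω)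
        = T * (∫ z, LTL.empRisk z (LTL.ridge (Dhat ω) z) ∂(LTL.datasetLaw ρ n)
          - ∫ z, LTL.empRisk z (LTL.ridge Dstar z) ∂(LTL.datasetLaw ρ n))
          - (∑ t, LTL.empRisk (Z t ω) (LTL.ridge (Dhat ω) (Z t ω))
          - ∑ t, LTL.empRisk (Z t ω) (LTL.ridge Dstar (Z t ω))) := by
      simp only [LTL.excess, Finset.sum_sub_distrib, Finset.sum_const, Finset.card_univ,
        Fintype.card_fin, nsmul_eq_mul]
      ring
    have hmin' : ∑ t, LTL.empRisk (Z t ω) (LTL.ridge (Dhat ω) (Z t ω))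
        ≤ ∑ t, LTL.empRisk (Z t ω) (LTL.ridge Dstar (Z t ω)) :=
      le_of_mul_le_mul_left hmin (by positivity)
    have hpop : ∫ z, LTL.empRisk z (LTL.ridge (Dhat ω) z) ∂(LTL.datasetLaw ρ n)
        - ∫ z, LTL.empRisk z (LTL.ridge Dstar z) ∂(LTL.datasetLaw ρ n)
        ≤ 2 * √(2 * Real.pi) / (lam * √T) + √(2 * Real.log (2 / δ) / T) := by
      refine le_of_mul_le_mul_left ?_ hT0
      have e1 : T * (2 * √(2 * Real.pi) / (lam * √T)) = 2 * √(2 * Real.pi) / lam * √T := by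
        nth_rw 1 [← hsT2]
        field_simp
      have e2 : T * √(2 * Real.log (2 / δ) / T) = √(2 * Real.log (2 / δ) * T) := by
        rw [Real.sqrt_div (by positivity), Real.sqrt_mul (by positivity) (T : ℝ)]
        nth_rw 1 [← hsT2]
        field_simp
      rw [mul_add, e1, e2]
      linarith
    have hpi : 1 ≤ √(2 * Real.pi) := by
      rw [Real.one_le_sqrt]
      linarith [Real.pi_gt_three]
    have hC : 0 ≤ 2 * √(LTL.opNorm (LTL.covMatrix ρ)) / √n * ((1 + √lam) / lam) := by positivity
    -- The two gaps together carry the constant 4; the stated constant is larger by the factor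
    -- `√(2π) ≥ 1`.
    have hfin : 2 * (2 * √(LTL.opNorm (LTL.covMatrix ρ)) / √n * ((1 + √lam) / lam))
        ≤ 4 * √(2 * Real.pi) * √(LTL.opNorm (LTL.covMatrix ρ)) / √n * ((1 + √lam) / lam) := by
      calc _ ≤ √(2 * Real.pi) *
            (2 * (2 * √(LTL.opNorm (LTL.covMatrix ρ)) / √n * ((1 + √lam) / lam))) :=
            le_mul_of_one_le_left (by positivity) hpi
        _ = _ := by ring
    linarith [hgap₁.2, hgap₂.1]
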